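/- Let $K$ be an algebraically closed field and let $A$ be a finite-dimensional $K$-multialgebra, i.e. a finite-dimensional $K$-vector space with a family of $K$-multilinear operations $\mu_i\colon A^{n_i}\to A$ $(i\in I,\ n_i\ge 0)$ (for example an algebra, with or without unit, possibly with an involution). A subalgebra is a $K$-subspace closed under all the operations; a maximal subalgebra is one that is maximal among the proper subalgebras. Varieties are identified with their sets of $K$-points; $A^r$, $\mathrm{GL}(A)\subseteq \mathrm{End}_K(A)$ and all their subsets carry the Zariski topology, and $\dim$ of a subset is its Krull dimension ($\dim\emptyset=-\infty$). Let $G$ be the identity component of the algebraic group $\mathrm{Aut}_K(A)\subseteq \mathrm{GL}(A)$ of multialgebra automorphisms. Suppose that the action of $G(K)$ on the set of maximal subalgebras of $A$ has finitely many orbits, represented by $A_1,\dots,A_t$ (one from each orbit). Let $r\ge 0$ be an integer, let $Z_r\subseteq A^r$ be the set of $r$-tuples that do not generate $A$, and for each $i$ let $X_i$ be the Zariski closure of $\bigcup_{g\in G(K)} g(A_i)^r$ in $A^r$. Then: (i) The irreducible components of $Z_r$ are precisely the maximal members, with respect to inclusion, of the family $X_1,\dots,X_t$. (ii) Writing $\mathrm{Stab}_G(A_i)=\{g\in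 G : g(A_i)=A_i\}$, we have $$\dim Z_r\ \le\ \dim G+\max_{1\le i\le t}\bigl(r\dim_K A_i-\dim \mathrm{Stab}_G(A_i)\bigr),$$ and equality holds if the maximum is attained at an index $i$ for which $A_i$ can be generated by $r$ elements. (If $t=0$, then $Z_r=\emptyset$ and the maximum is read as $-\infty$.) -/

import Mathlib

namespace Multialg

/-! ### The Zariski topology on a vector space, on its general linear group, and dimension -/

section Zariski

variable (K : Type*) [Field K] (V : Type*) [AddCommGroup V] [Module K V]

/-- The `K`-algebra of polynomial functions on `V`, that is, the algebra of functions
generated by the linear functionals (equivalently, by the coordinates in any basis). -/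
def polyFun : Subalgebra K (V → K) :=
  Algebra.adjoin K (Set.range fun f : Module.Dual K V => (fun v => f v : V → K))

variable {K V} in
/-- The set of common zeros of a set of functions. -/
def commonZeros (S : Set (V → K)) : Set V := {v | ∀ p ∈ S, p v = 0}

/-- The Zariski topology on `V`, viewed as an affine space: the closed sets are the sets of
common zeros of polynomial functions. -/
@[reducible] def zariski : TopologicalSpace V :=
  TopologicalSpace.ofClosed {Z | ∃ S : Set (V → K), S ⊆ polyFun K V ∧ Z = commonZeros S}
    ⟨{1}, Set.singleton_subset_iff.2 (polyFun K V).one_mem, by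
      ext v; simp [commonZeros]⟩
    (by
      intro C hC
      have hC' : ∀ Z ∈ C, ∃ S : Set (V → K), S ⊆ polyFun K V ∧ Z = commonZeros S :=
        fun Z h => hC h
      choose! S hS hZ using hC'
      refine ⟨⋃ Z ∈ C, S Z, Set.iUnion₂_subset fun Z h => hS Z h, ?_⟩
      ext v
      simp only [Set.mem_sInter, commonZeros, Set.mem_iUnion, Set.mem_ofPred_eq]
      constructor
      · rintro h p ⟨Z, hZC, hp⟩
        have h1 := h Z hZC
        rw [hZ Z hZC] at h1
        exact h1 p hp
      · intro h Z hZC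
        rw [hZ Z hZC]
        exact fun p hp => h p ⟨Z, hZC, hp⟩)
    (by
      rintro _ ⟨S, hS, rfl⟩ _ ⟨T, hT, rfl⟩
      refine ⟨{f | ∃ p ∈ S, ∃ q ∈ T, f = p * q}, ?_, ?_⟩
      · rintro _ ⟨p, hp, q, hq, rfl⟩
        exact (polyFun K V).mul_mem (hS hp) (hT hq)
      · ext v
        simp only [commonZeros, Set.mem_union, Set.mem_ofPred_eq]
        constructor
        · rintro (h | h) _ ⟨p, hp, q, hq, rfl⟩
          · simp [h p hp]
          · simp [h q hq]
        · intro h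
          by_contra hc
          push Not at hc
          obtain ⟨⟨p, hp, hp0⟩, q, hq, hq0⟩ := hc
          exact mul_ne_zero hp0 hq0 (h _ ⟨p, hp, q, hq, rfl⟩))

/-- The Zariski topology on `GL(V)`, as an open subset of the affine space `End(V)`. -/
@[reducible] def zariskiGL : TopologicalSpace (V ≃ₗ[K] V) :=
  (zariski K (V →ₗ[K] V)).induced fun g => (g : V →ₗ[K] V)

variable {K V}

theorem isClosed_zariski_iff {Z : Set V} :
    @IsClosed V (zariski K V) Z ↔
      ∃ S : Set (V → K), S ⊆ polyFun K V ∧ Z = commonZeros S := by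
  rw [← @isOpen_compl_iff V Z (zariski K V)]
  change Zᶜᶜ ∈ {Z | ∃ S : Set (V → K), S ⊆ polyFun K V ∧ Z = commonZeros S} ↔ _
  rw [compl_compl]
  rfl

/-- A linear map is continuous in the Zariski topologies. -/
theorem continuous_zariski {W : Type*} [AddCommGroup W] [Module K W] (f : V →ₗ[K] W) :
    @Continuous V W (zariski K V) (zariski K W) f := by
  let := zariski K V
  let := zariski K W
  refine continuous_iff_isClosed.2 fun Z hZ => ?_
  obtain ⟨S, hS, rfl⟩ := isClosed_zariski_iff.1 hZ
  refine isClosed_zariski_iff.2 ⟨(fun p => p ∘ f) '' S, ?_, ?_⟩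
  · rintro _ ⟨p, hp, rfl⟩
    have hp' : p ∈ Algebra.adjoin K _ := hS hp
    change p ∘ f ∈ polyFun K V
    clear hp
    induction hp' using Algebra.adjoin_induction with
    | mem p hp =>
      obtain ⟨l, rfl⟩ := hp
      exact Algebra.subset_adjoin ⟨l.comp f, rfl⟩
    | algebraMap c => exact (polyFun K V).algebraMap_mem c
    | add p q _ _ h1 h2 => exact (polyFun K V).add_mem h1 h2
    | mul p q _ _ h1 h2 => exact (polyFun K V).mul_mem h1 h2
  · ext v
    simp [commonZeros]

/-- Left translations of `GL(V)` are continuous in the Zariski topology. -/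
theorem continuous_zariskiGL_mul_left (g : V ≃ₗ[K] V) :
    @Continuous _ _ (zariskiGL K V) (zariskiGL K V) (fun h => g * h) := by
  let := zariski K (V →ₗ[K] V)
  let := zariskiGL K V
  refine continuous_induced_rng.2 ?_
  exact (continuous_zariski (LinearMap.mulLeft K ((g : V →ₗ[K] V) : Module.End K V))).comp
    continuous_induced_dom

/-- The subset `S` of the topological space `(X, τ)`, with the subspace topology, has Krull
dimension `d`. Here `d = ⊥` encodes the dimension `-∞` of the empty set. -/
def HasDim {X : Type*} (τ : TopologicalSpace X) (S : Set X) (d : WithBot ℕ) : Prop :=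
  letI := τ
  topologicalKrullDim S = d.map (Nat.cast : ℕ → ℕ∞)

/-- The irreducible components of the subset `S` of the topological space `(X, τ)`, with the
subspace topology, as subsets of `X`. -/
def components {X : Type*} (τ : TopologicalSpace X) (S : Set X) : Set (Set X) :=
  letI := τ
  (fun C : Set S => Subtype.val '' C) '' irreducibleComponents S

end Zariski

/-! ### Multialgebras

A multialgebra is a vector space `A` with a family of multilinear operations `μ i`, the `i`-th
one having `n i` arguments. -/

section Multialgebra

variable {K : Type*} [Field K] {A : Type*} [AddCommGroup A] [Module K A]
  {I : Type*} {n : I → ℕ} (μ : ∀ i, MultilinearMap K (fun _ : Fin (n i) => A) A)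

/-- A subspace is a subalgebra if it is closed under all the operations. -/
def IsSubalgebra (B : Submodule K A) : Prop :=
  ∀ i (x : Fin (n i) → A), (∀ j, x j ∈ B) → μ i x ∈ B

/-- The subalgebra generated by a set. -/
def generated (S : Set A) : Submodule K A :=
  sInf {B | IsSubalgebra μ B ∧ S ⊆ B}

/-- Maximal subalgebras, i.e. those maximal among the proper subalgebras. -/
def IsMaximalSubalgebra (B : Submodule K A) : Prop :=
  Maximal (fun C => IsSubalgebra μ C ∧ C ≠ ⊤) B

/-- The `r`-tuples which do not generate `A`. -/
def nonGenerating (r : ℕ) : Set (Fin r → A) :=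
  {a | generated μ (Set.range a) ≠ ⊤}

/-- The group of automorphisms of the multialgebra, inside `GL(A)`. -/
def autGroup : Subgroup (A ≃ₗ[K] A) where
  carrier := {g | ∀ i x, g (μ i x) = μ i (fun j => g (x j))}
  one_mem' := fun _ _ => rfl
  mul_mem' := by
    intro g h hg hh i x
    simp only [LinearEquiv.mul_apply]
    rw [hh i x, hg i]
  inv_mem' := by
    intro g hg i x
    apply g.injective
    rw [hg i]
    simp

/-- The identity component of the automorphism group: the connected component of `1` in the
Zariski topology. -/
def autZero : Subgroup (A ≃ₗ[K] A) :=
  letI := zariskiGL K A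
  have h1 : (1 : A ≃ₗ[K] A) ∈ (autGroup μ : Set (A ≃ₗ[K] A)) := (autGroup μ).one_mem
  have key : ∀ g x : A ≃ₗ[K] A, g ∈ autGroup μ →
      x ∈ connectedComponentIn (autGroup μ : Set (A ≃ₗ[K] A)) 1 →
      g * x ∈ connectedComponentIn (autGroup μ : Set (A ≃ₗ[K] A)) 1 →
      ∀ y ∈ connectedComponentIn (autGroup μ : Set (A ≃ₗ[K] A)) 1,
        g * y ∈ connectedComponentIn (autGroup μ : Set (A ≃ₗ[K] A)) 1 := by
    intro g x hg hx hgx y hy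
    have hc := (isPreconnected_connectedComponentIn
      (F := (autGroup μ : Set (A ≃ₗ[K] A))) (x := 1)).image (fun h => g * h)
      (continuous_zariskiGL_mul_left g).continuousOn
    have hsub := hc.subset_connectedComponentIn (F := (autGroup μ : Set (A ≃ₗ[K] A)))
      (Set.mem_image_of_mem _ hx) (by
        rintro _ ⟨z, hz, rfl⟩
        exact (autGroup μ).mul_mem hg (connectedComponentIn_subset _ _ hz))
    rw [← connectedComponentIn_eq hgx] at hsub
    exact hsub (Set.mem_image_of_mem _ hy)
  { carrier := connectedComponentIn (autGroup μ : Set (A ≃ₗ[K] A)) 1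
    one_mem' := mem_connectedComponentIn h1
    mul_mem' := by
      intro g h hg hh
      exact key g 1 (connectedComponentIn_subset _ _ hg) (mem_connectedComponentIn h1)
        (by simpa using hg) h hh
    inv_mem' := by
      intro g hg
      have := key g⁻¹ g ((autGroup μ).inv_mem (connectedComponentIn_subset _ _ hg)) hg
        (by simpa using mem_connectedComponentIn h1) 1 (mem_connectedComponentIn h1)
      simpa using this }

/-- The stabilizer of a subspace `B` in the identity component of the automorphism group. -/
def stab (B : Submodule K A) : Subgroup (A ≃ₗ[K] A) where
  carrier := {g | g ∈ autZero μ ∧ B.map (g : A →ₗ[K] A) = B}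
  one_mem' := ⟨(autZero μ).one_mem, Submodule.map_id B⟩
  mul_mem' := by
    rintro g h ⟨hg, hgB⟩ ⟨hh, hhB⟩
    refine ⟨(autZero μ).mul_mem hg hh, ?_⟩
    have : ((g * h : A ≃ₗ[K] A) : A →ₗ[K] A) = (g : A →ₗ[K] A).comp (h : A →ₗ[K] A) := rfl
    rw [this, Submodule.map_comp, hhB, hgB]
  inv_mem' := by
    rintro g ⟨hg, hgB⟩
    refine ⟨(autZero μ).inv_mem hg, ?_⟩
    conv_lhs => rw [← hgB]
    rw [← Submodule.map_comp]
    have : ((g⁻¹ : A ≃ₗ[K] A) : A →ₗ[K] A).comp (g : A →ₗ[K] A) = LinearMap.id := by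
      ext x
      exact g.symm_apply_apply x
    rw [this, Submodule.map_id]

/-- The Zariski closure in `A ^ r` of the union of the sets `g(B) ^ r`, where `g` ranges over the
identity component of the automorphism group. -/
def sweep (r : ℕ) (B : Submodule K A) : Set (Fin r → A) :=
  @closure _ (zariski K (Fin r → A))
    (⋃ g ∈ autZero μ, {a | ∀ j, a j ∈ B.map (g : A →ₗ[K] A)})

end Multialgebra

end Multialg

/-! ### Dimension of integral extensions and Noether normalization -/

/-! Write `G` for the identity component of the automorphism group. In finite dimension every proper
subalgebra lies in a maximal one, hence in some `g(A_i)`, so the non-generating tuples are exactly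
the tuples lying in some `g(A_i)^r`. Generating is an open condition: the elements generated by a
tuple are values of polynomial maps in the tuple, and a nonvanishing determinant certifies that such
values span (`exists_polyFun_generated_eq`). So `Z_r` is closed and equals the finite union of the
`X_i`.

Each `X_i` is the closure of the image of `G × A_i^r` under `(g, w) ↦ g w`. The group `G` is
irreducible, being the identity component of a Noetherian group, so `X_i` is irreducible. In a
finite union of closed irreducible sets the components are the maximal members, which is (i).

For (ii), `dim X_i = dim G + r dim A_i - d`, where `d` is the dimension of a general fibre of this
map (`exists_dim_fiber`). The fibre through `(g, w)` contains the copy `s ↦ (g s⁻¹, s w)` of the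
stabilizer, whence the inequality. If `w` generates `A_i`, the copy is the whole fibre: `g' w' = g
w` says that the automorphism `g'⁻¹ g` carries the generators `w` into `A_i`, so it stabilizes
`A_i`. When `A_i` is generated by `r` elements such `w` form a nonempty open set, which meets the
locus of general fibres, so equality holds for `X_i`.

The theorem on fibres comes from a Noether normalization valid over a nonempty open part of the
base. Varieties are handled as sets with an algebra of functions; for a finitely generated algebra
all of whose characters are evaluations, the Nullstellensatz equates topological dimension with
Krull dimension. -/

theorem Order.krullDim_le_of_lifts {α β : Type*} [Preorder α] [Preorder β] (f : α → β)
    (hf : Function.Surjective f) (hl : ∀ a b, f a < b → ∃ a', a < a' ∧ f a' = b) :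
    Order.krullDim β ≤ Order.krullDim α := by
  have key : ∀ n (p : LTSeries β), p.length = n → ∀ a, f a = p.head →
      ∃ q : LTSeries α, q.length = p.length ∧ q.head = a := by
    intro n
    induction n with
    | zero =>
      intro p hp a _
      exact ⟨RelSeries.singleton _ a, by simp [hp], by simp⟩
    | succ n ih =>
      intro p hp a ha
      have h0 : p.length ≠ 0 := by omega
      have h1 : f a < (p.tail h0).head := by
        rw [ha, RelSeries.head_tail]
        refine p.strictMono (Fin.lt_def.2 ?_)
        simp [Nat.mod_eq_of_lt (show 1 < p.length + 1 by omega)]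
      obtain ⟨a', haa', hfa'⟩ := hl a _ h1
      obtain ⟨q, hq, hqh⟩ := ih (p.tail h0) (by simp [hp]) a' hfa'
      refine ⟨q.cons a (by simpa [hqh] using haa'), ?_, by simp⟩
      simp [hq, hp]
  refine iSup_le fun p => ?_
  obtain ⟨a, ha⟩ := hf p.head
  obtain ⟨q, hq, -⟩ := key _ p rfl a ha
  rw [← hq]
  exact le_iSup (fun q : LTSeries α => (q.length : WithBot ℕ∞)) q

/-- Lying over and going up lift chains of primes from `R` to `S`; incomparability makes contraction
of primes strictly monotone. -/
theorem ringKrullDim_eq_of_isIntegral {R S : Type*} [CommRing R] [CommRing S] [Algebra R S]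
    [Algebra.IsIntegral R S] (hinj : Function.Injective (algebraMap R S)) :
    ringKrullDim R = ringKrullDim S := by
  have hker : ∀ P : Ideal R, RingHom.ker (algebraMap R S) ≤ P := fun P => by
    rw [(RingHom.injective_iff_ker_eq_bot _).1 hinj]; exact bot_le
  refine le_antisymm ?_ ?_
  · refine Order.krullDim_le_of_lifts (PrimeSpectrum.comap (algebraMap R S)) ?_ ?_
    · intro P
      obtain ⟨Q, hQ, hQP⟩ := Ideal.exists_ideal_over_prime_of_isIntegral (S := S) P.asIdeal ⊥
        (hker _)
      exact ⟨⟨Q, hQP.1⟩, PrimeSpectrum.ext hQP.2⟩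
    · intro Q P hP
      obtain ⟨Q', hle, hQ', hQP⟩ := Ideal.exists_ideal_over_prime_of_isIntegral P.asIdeal Q.asIdeal
        hP.le
      refine ⟨⟨Q', hQ'⟩, lt_of_le_of_ne hle ?_, PrimeSpectrum.ext hQP⟩
      rintro rfl
      exact hP.ne (PrimeSpectrum.ext hQP)
  · refine Order.krullDim_le_of_strictMono (PrimeSpectrum.comap (algebraMap R S)) ?_
    intro P Q h
    exact Ideal.IsIntegral.comap_lt_comap (show P.asIdeal < Q.asIdeal from h)

theorem ringKrullDim_eq_card_of_isIntegral {K R ι : Type*} [Field K] [CommRing R] [Algebra K R]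
    [Finite ι] {t : ι → R} (ht : AlgebraicIndependent K t)
    (hint : (MvPolynomial.aeval t : MvPolynomial ι K →ₐ[K] R).IsIntegral) :
    ringKrullDim R = Nat.card ι := by
  algebraize [(MvPolynomial.aeval t : MvPolynomial ι K →ₐ[K] R).toRingHom]
  rw [← ringKrullDim_eq_of_isIntegral (R := MvPolynomial ι K) (S := R) ht,
    MvPolynomial.ringKrullDim_of_isNoetherianRing, ringKrullDim_eq_zero_of_field]
  simp

/-- An element with an integral nonzero multiple is algebraic over `A[t]`. Allowing the factor `h`
covers the generic normalization as well as the classical one, where `h = 1`. -/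
theorem isTranscendenceBasis_of_isIntegral {A R ι : Type*} [CommRing A] [CommRing R] [Algebra A R]
    [Nontrivial R] [NoZeroDivisors R]
    {t : ι → R} (ht : AlgebraicIndependent A t)
    (hint : ∀ b : R, ∃ h : A, h ≠ 0 ∧
      (MvPolynomial.aeval t : MvPolynomial ι A →ₐ[A] R).toRingHom.IsIntegralElem
        (algebraMap A R h * b)) :
    IsTranscendenceBasis A t := by
  have hdom : IsDomain R := { }
  have : FaithfulSMul A R :=
    (faithfulSMul_iff_algebraMap_injective A R).mpr ht.algebraMap_injective
  have : IsDomain A := ht.algebraMap_injective.isDomain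
  refine ht.isTranscendenceBasis_iff_isAlgebraic.2 ⟨fun b => ?_⟩
  obtain ⟨h, h0, p, hp, hpb⟩ := hint b
  have hfac : (MvPolynomial.aeval t : MvPolynomial ι A →ₐ[A] R).toRingHom =
      (algebraMap (Algebra.adjoin A (Set.range t)) R).comp
        (ht.aevalEquiv : MvPolynomial ι A →+* Algebra.adjoin A (Set.range t)) := by
    ext <;> simp
  have hi : IsIntegral (Algebra.adjoin A (Set.range t)) (algebraMap A R h * b) := by
    refine ⟨p.map (ht.aevalEquiv : MvPolynomial ι A →+* Algebra.adjoin A (Set.range t)),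
      hp.map _, ?_⟩
    rw [Polynomial.eval₂_map, ← hfac, hpb]
  have h1 : algebraMap A R h ≠ 0 := fun h' => h0 (ht.algebraMap_injective (by simpa using h'))
  refine IsAlgebraic.of_mul (mem_nonZeroDivisors_of_ne_zero h1) ?_ hi.isAlgebraic
  exact isAlgebraic_algebraMap (algebraMap A (Algebra.adjoin A (Set.range t)) h)

theorem exists_noether_normalization (K R : Type*) [Field K] [CommRing R] [IsDomain R]
    [Algebra K R] [Algebra.FiniteType K R] :
    ∃ (n : ℕ) (t : Fin n → R), IsTranscendenceBasis K t ∧ ringKrullDim R = n := by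
  obtain ⟨n, g, hinj, hint⟩ := exists_integral_inj_algHom_of_fg K R
  have hg : g = MvPolynomial.aeval (fun i => g (MvPolynomial.X i)) := MvPolynomial.aeval_unique g
  have ht : AlgebraicIndependent K (fun i => g (MvPolynomial.X i)) := by
    rw [AlgebraicIndependent, ← hg]; exact hinj
  refine ⟨n, _, isTranscendenceBasis_of_isIntegral ht fun b => ⟨1, one_ne_zero, ?_⟩, ?_⟩
  · rw [← hg]; simpa using hint b
  · rw [ringKrullDim_eq_card_of_isIntegral ht (by rw [← hg]; exact hint)]
    simp

theorem ringKrullDim_eq_card_of_isTranscendenceBasis {K R ι : Type*} [Field K] [CommRing R]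
    [IsDomain R] [Algebra K R] [Algebra.FiniteType K R] [Finite ι] {t : ι → R}
    (ht : IsTranscendenceBasis K t) : ringKrullDim R = Nat.card ι := by
  obtain ⟨n, x, hx, hn⟩ := exists_noether_normalization K R
  have := congrArg Cardinal.toNat (ht.lift_cardinalMk_eq hx)
  simp only [Cardinal.toNat_lift] at this
  rw [hn, Nat.card, this]
  simp

/-! ### Noether normalization over a nonempty open part of the base. -/

section GenericNoether

attribute [local instance] MvPolynomial.algebraMvPolynomial Algebra.TensorProduct.rightAlgebra

open scoped TensorProduct nonZeroDivisors

/-- Normalize the generic fibre `Frac(A) ⊗ R` over the field `Frac(A)`, then clear the denominators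
of the parameters and of the integral equations. -/
theorem exists_generic_noether_normalization (A R : Type*) [CommRing A] [CommRing R] [IsDomain R]
    [Algebra A R] [FaithfulSMul A R] [Algebra.FiniteType A R] :
    ∃ (s : ℕ) (t : Fin s → R) (h : A), AlgebraicIndependent A t ∧ h ≠ 0 ∧ ∀ b : R, ∃ N : ℕ,
      (MvPolynomial.aeval t : MvPolynomial (Fin s) A →ₐ[A] R).toRingHom.IsIntegralElem
        (algebraMap A R h ^ N * b) := by
  have hAR := FaithfulSMul.algebraMap_injective A R
  have : IsDomain A := hAR.isDomain
  let F := FractionRing A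
  let S := F ⊗[A] R
  let ι : R →ₐ[A] S := Algebra.TensorProduct.includeRight
  have hloc : IsLocalization (Algebra.algebraMapSubmonoid R A⁰) S :=
    IsLocalization.tensorRight F A⁰
  have hM : Algebra.algebraMapSubmonoid R A⁰ ≤ R⁰ := by
    rintro _ ⟨a, ha, rfl⟩
    exact mem_nonZeroDivisors_of_ne_zero fun h => nonZeroDivisors.ne_zero ha
      (hAR (by simpa using h))
  have hι : Function.Injective ι := IsLocalization.injective S hM
  have hS : IsDomain S := IsLocalization.isDomain_of_le_nonZeroDivisors S hM
  have hden : ∀ z : S, ∃ a : A, a ≠ 0 ∧ ∃ r : R, algebraMap F S (algebraMap A F a) * z = ι r := by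
    intro z
    obtain ⟨⟨r, ⟨_, a, ha, rfl⟩⟩, h⟩ := IsLocalization.surj (Algebra.algebraMapSubmonoid R A⁰) z
    refine ⟨a, nonZeroDivisors.ne_zero ha, r, ?_⟩
    have h' : ι (algebraMap A R a) = algebraMap F S (algebraMap A F a) := by
      rw [AlgHom.commutes, IsScalarTower.algebraMap_apply A F S]
    rw [mul_comm, ← h']
    exact h
  obtain ⟨s, g, hg, hgi⟩ := exists_integral_inj_algHom_of_fg F S
  choose a ha t hat using fun i => hden (g (MvPolynomial.X i))
  obtain ⟨c, hc⟩ : ∃ c : Fin s → F, ∀ i, algebraMap A F (a i) = c i := ⟨_, fun _ => rfl⟩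
  have hc0 : ∀ i, c i ≠ 0 := fun i h =>
    ha i (IsFractionRing.injective A F (by simpa [hc i] using h))
  -- Rescaling the variables by the nonzero `c i` is an automorphism, so `g ∘ σ` is still injective
  -- and integral, but now sends the variables into `R`.
  let σ : MvPolynomial (Fin s) F →ₐ[F] MvPolynomial (Fin s) F :=
    MvPolynomial.aeval fun i => MvPolynomial.C (c i) * MvPolynomial.X i
  let σ' : MvPolynomial (Fin s) F →ₐ[F] MvPolynomial (Fin s) F :=
    MvPolynomial.aeval fun i => MvPolynomial.C (c i)⁻¹ * MvPolynomial.X i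
  have h1 : σ.comp σ' = AlgHom.id F _ := by
    ext i : 1
    simp only [σ, σ', AlgHom.comp_apply, MvPolynomial.aeval_X, map_mul, MvPolynomial.aeval_C,
      MvPolynomial.algebraMap_eq, ← mul_assoc, ← MvPolynomial.C_mul, inv_mul_cancel₀ (hc0 i),
      map_one, one_mul, AlgHom.id_apply]
  have h2 : σ'.comp σ = AlgHom.id F _ := by
    ext i : 1
    simp only [σ, σ', AlgHom.comp_apply, MvPolynomial.aeval_X, map_mul, MvPolynomial.aeval_C,
      MvPolynomial.algebraMap_eq, ← mul_assoc, ← MvPolynomial.C_mul,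
      mul_inv_cancel₀ (hc0 i), map_one, one_mul, AlgHom.id_apply]
  let g' := g.comp σ
  have hg' : Function.Injective g' := by
    refine hg.comp (Function.LeftInverse.injective (g := σ') fun x => ?_)
    exact DFunLike.congr_fun h2 x
  have hgi' : g'.toRingHom.IsIntegral := by
    refine RingHom.IsIntegral.trans σ.toRingHom g.toRingHom (RingHom.isIntegral_of_surjective _ ?_)
      hgi
    exact Function.RightInverse.surjective (g := σ') fun x => DFunLike.congr_fun h1 x
  have hX : ∀ i, g' (MvPolynomial.X i) = ι (t i) := by
    intro i
    simp only [g', σ, AlgHom.comp_apply, MvPolynomial.aeval_X, map_mul, ← hat, ← hc]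
    rw [← MvPolynomial.algebraMap_eq, AlgHom.commutes]
  have hcomp : g'.toRingHom.comp (MvPolynomial.map (algebraMap A F)) =
      ι.toRingHom.comp (MvPolynomial.aeval t : MvPolynomial (Fin s) A →ₐ[A] R).toRingHom := by
    ext x
    · simp [← IsScalarTower.algebraMap_apply]
    · simpa using hX x
  have ht : AlgebraicIndependent A t := by
    have : Function.Injective (g'.toRingHom.comp (MvPolynomial.map (algebraMap A F))) :=
      Function.Injective.comp (g := g'.toRingHom) hg'
        (MvPolynomial.map_injective _ (IsFractionRing.injective A F))
    rw [hcomp] at this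
    exact Function.Injective.of_comp (f := ι) this
  have hone : ∀ b : R, ∃ h : A, h ≠ 0 ∧
      (MvPolynomial.aeval t : MvPolynomial (Fin s) A →ₐ[A] R).toRingHom.IsIntegralElem
        (algebraMap A R h * b) := by
    intro b
    let i1 : Algebra (MvPolynomial (Fin s) F) S := g'.toRingHom.toAlgebra
    let i2 : Algebra (MvPolynomial (Fin s) A) S :=
      (g'.toRingHom.comp (MvPolynomial.map (algebraMap A F))).toAlgebra
    have i3 : IsScalarTower (MvPolynomial (Fin s) A) (MvPolynomial (Fin s) F) S :=
      IsScalarTower.of_algebraMap_eq fun x => rfl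
    have hb : IsIntegral (MvPolynomial (Fin s) F) (ι b) := hgi' _
    obtain ⟨⟨_, h, hh, rfl⟩, p, hp, hpb⟩ :=
      hb.exists_multiple_integral_of_isLocalization (A⁰.map (MvPolynomial.C (σ := Fin s)))
    refine ⟨h, nonZeroDivisors.ne_zero hh, p, hp, hι ?_⟩
    have h3 : algebraMap (MvPolynomial (Fin s) A) S =
      ι.toRingHom.comp (MvPolynomial.aeval t : MvPolynomial (Fin s) A →ₐ[A] R).toRingHom := hcomp
    have h4 : ((⟨MvPolynomial.C h, h, hh, rfl⟩ : A⁰.map (MvPolynomial.C (σ := Fin s))) • ι b : S) =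
        ι.toRingHom (algebraMap A R h * b) := by
      rw [Submonoid.smul_def, Algebra.smul_def, h3]
      simp
    rw [h3] at hpb
    erw [h4] at hpb
    rw [← Polynomial.hom_eval₂] at hpb
    rw [map_zero]
    exact hpb
  classical
  obtain ⟨W, hW⟩ := Algebra.FiniteType.out (R := A) (A := R)
  choose h h0 hh using hone
  -- One denominator serves the finitely many generators of `R`; sums and products of generators
  -- then need powers of it.
  refine ⟨s, t, ∏ w ∈ W, h w, ht, Finset.prod_ne_zero_iff.2 fun w _ => h0 w, fun b => ?_⟩
  have hA : ∀ x : A, (MvPolynomial.aeval t :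
      MvPolynomial (Fin s) A →ₐ[A] R).toRingHom.IsIntegralElem (algebraMap A R x) := fun x => by
    have := RingHom.isIntegralElem_map (f := (MvPolynomial.aeval t :
      MvPolynomial (Fin s) A →ₐ[A] R).toRingHom) (x := MvPolynomial.C x)
    simpa using this
  have hb : b ∈ Algebra.adjoin A (W : Set R) := hW ▸ Algebra.mem_top
  induction hb using Algebra.adjoin_induction with
  | mem w hw =>
    refine ⟨1, ?_⟩
    have := (hA (∏ v ∈ W.erase w, h v)).mul _ (hh w)
    rw [← mul_assoc, ← map_mul, Finset.prod_erase_mul _ _ hw] at this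
    simpa using this
  | algebraMap c => exact ⟨0, by simpa using hA c⟩
  | add x y _ _ hx hy =>
    obtain ⟨N, hN⟩ := hx
    obtain ⟨M, hM⟩ := hy
    refine ⟨N + M, ?_⟩
    have := ((hA ((∏ w ∈ W, h w) ^ M)).mul _ hN).add _ ((hA ((∏ w ∈ W, h w) ^ N)).mul _ hM)
    convert this using 1
    simp only [map_pow]
    ring
  | mul x y _ _ hx hy =>
    obtain ⟨N, hN⟩ := hx
    obtain ⟨M, hM⟩ := hy
    refine ⟨N + M, ?_⟩
    convert hN.mul _ hM using 1
    ring

end GenericNoether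

/-- Lying over gives a prime `Q` above `m` in the integral closure of `T` in `R`. Each element of
`mR` is carried into `Q` by a power of `h`, so `1 ∈ mR` would put a power of `h` in `Q ∩ T = m`. -/
theorem map_ne_top_of_isIntegralElem_pow_mul {T R : Type*} [CommRing T] [CommRing R]
    (g : T →+* R) (hg : Function.Injective g) (h : T)
    (hint : ∀ b : R, ∃ N : ℕ, g.IsIntegralElem (g h ^ N * b))
    (m : Ideal T) [m.IsPrime] (hm : h ∉ m) : m.map g ≠ ⊤ := by
  algebraize [g]
  let R' := integralClosure T R
  have hinj : Function.Injective (algebraMap T R') := by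
    intro a b hab
    exact hg (congrArg Subtype.val hab)
  obtain ⟨Q, -, hQ, hQm⟩ := Ideal.exists_ideal_over_prime_of_isIntegral (S := R') m ⊥ (by
    change RingHom.ker (algebraMap T R') ≤ m
    rw [(RingHom.injective_iff_ker_eq_bot _).1 hinj]; exact bot_le)
  have key : ∀ z ∈ m.map g, ∃ (N : ℕ) (z' : R'), z' ∈ Q ∧ (z' : R) = g h ^ N * z := by
    intro z hz
    induction hz using Submodule.span_induction with
    | mem z hz =>
      obtain ⟨a, ha, rfl⟩ := hz
      refine ⟨0, algebraMap T R' a, ?_, by simp; rfl⟩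
      rw [← Ideal.mem_comap, hQm]; exact ha
    | zero => exact ⟨0, 0, Q.zero_mem, by simp⟩
    | add x y _ _ hx hy =>
      obtain ⟨N, x', hx', hx⟩ := hx
      obtain ⟨M, y', hy', hy⟩ := hy
      refine ⟨N + M, algebraMap T R' h ^ M * x' + algebraMap T R' h ^ N * y',
        Q.add_mem (Q.mul_mem_left _ hx') (Q.mul_mem_left _ hy'), ?_⟩
      have : ((algebraMap T R' h : R') : R) = g h := rfl
      simp only [AddMemClass.coe_add, MulMemClass.coe_mul, SubmonoidClass.coe_pow, hx, hy, this]
      ring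
    | smul b x _ hx =>
      obtain ⟨N, x', hx', hx⟩ := hx
      obtain ⟨M, hM⟩ := hint b
      refine ⟨N + M, ⟨_, hM⟩ * x', Q.mul_mem_left _ hx', ?_⟩
      simp only [MulMemClass.coe_mul, hx, smul_eq_mul]
      ring
  intro htop
  obtain ⟨N, z', hz', hz⟩ := key 1 (htop ▸ Submodule.mem_top)
  have hz'' : z' = algebraMap T R' (h ^ N) := by
    apply Subtype.ext
    rw [hz, mul_one, map_pow]
    rfl
  rw [hz'', ← Ideal.mem_comap, hQm] at hz'
  exact hm (Ideal.IsPrime.mem_of_pow_mem inferInstance N hz')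

/-- Over a point of the base with `h ≠ 0`, the parameters `t` can take arbitrary values: the proper
ideal `I` is what the Nullstellensatz turns into a point. It is extended from the kernel of the
evaluation of `A[t]` at `(φ, c)`. -/
theorem exists_ideal_ne_top_over {A R K ι : Type*} [CommRing A] [CommRing R] [Algebra A R]
    [Field K] (φ : A →+* K) {t : ι → R} (ht : AlgebraicIndependent A t) {h : A} (hφ : φ h ≠ 0)
    (hint : ∀ b : R, ∃ N : ℕ,
      (MvPolynomial.aeval t : MvPolynomial ι A →ₐ[A] R).toRingHom.IsIntegralElem
        (algebraMap A R h ^ N * b)) (c : ι → K) :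
    ∃ I : Ideal R, I ≠ ⊤ ∧ (∀ a, φ a = 0 → algebraMap A R a ∈ I) ∧
      ∀ i a, φ a = c i → t i - algebraMap A R a ∈ I := by
  let g : MvPolynomial ι A →+* R := (MvPolynomial.aeval t : MvPolynomial ι A →ₐ[A] R).toRingHom
  have hgC : ∀ p, g (MvPolynomial.C p) = algebraMap A R p := fun p => by simp [g]
  have hgX : ∀ i, g (MvPolynomial.X i) = t i := fun p => by simp [g]
  let ψ : MvPolynomial ι A →+* K := MvPolynomial.eval₂Hom φ c
  have hm : (RingHom.ker ψ).IsPrime := RingHom.ker_isPrime _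
  refine ⟨(RingHom.ker ψ).map g, map_ne_top_of_isIntegralElem_pow_mul g ht (MvPolynomial.C h)
    (fun b => by rw [hgC]; exact hint b) _ (by simpa [RingHom.mem_ker, ψ] using hφ), ?_, ?_⟩
  · intro a ha
    rw [← hgC]
    exact Ideal.mem_map_of_mem _ (by simpa [RingHom.mem_ker, ψ] using ha)
  · intro i a ha
    rw [← hgC, ← hgX, ← map_sub]
    exact Ideal.mem_map_of_mem _ (by simp [RingHom.mem_ker, ψ, ha])

/-! ### Algebras of functions and their Zariski topology -/

namespace FunAlg

open MvPolynomial
open scoped Topology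

variable {K : Type*} [Field K] {X Y : Type*}

/-- Precomposition with a map, as a homomorphism of algebras of functions. -/
def pullHom (K : Type*) [Field K] (f : Y → X) : (X → K) →ₐ[K] (Y → K) :=
  AlgHom.pi fun y => Pi.evalAlgHom K _ (f y)

@[simp] theorem pullHom_apply (f : Y → X) (p : X → K) (y : Y) : pullHom K f p y = p (f y) := rfl

/-- Evaluation at a point. -/
def ev (R : Subalgebra K (X → K)) (x : X) : R →ₐ[K] K :=
  (Pi.evalAlgHom K (fun _ => K) x).comp R.val

@[simp] theorem ev_apply (R : Subalgebra K (X → K)) (x : X) (f : R) : ev R x f = f.1 x := rfl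

/-- The map from the points to the spectrum. -/
def toSpec (R : Subalgebra K (X → K)) (x : X) : PrimeSpectrum R :=
  ⟨RingHom.ker (ev R x), RingHom.ker_isPrime _⟩

/-- The Zariski topology defined by an algebra of functions. -/
@[reducible] def funTop (R : Subalgebra K (X → K)) : TopologicalSpace X :=
  PrimeSpectrum.zariskiTopology.induced (toSpec R)

/-- The restriction of an algebra of functions along a map. -/
def pull (f : Y → X) (R : Subalgebra K (X → K)) : Subalgebra K (Y → K) := R.map (pullHom K f)

theorem pull_pull {Z : Type*} (f : Y → X) (g : Z → Y) (R : Subalgebra K (X → K)) :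
    pull g (pull f R) = pull (f ∘ g) R := by
  simp only [pull, Subalgebra.map_map]
  rfl

/-- Precomposition as a map between algebras of functions. -/
def toPull (f : Y → X) (R : Subalgebra K (X → K)) : R →ₐ[K] pull f R :=
  ((pullHom K f).comp R.val).codRestrict _ fun r => ⟨r, r.2, rfl⟩

@[simp] theorem toPull_apply (f : Y → X) (R : Subalgebra K (X → K)) (r : R) (y : Y) :
    (toPull f R r).1 y = r.1 (f y) := rfl

theorem toPull_surjective (f : Y → X) (R : Subalgebra K (X → K)) :
    Function.Surjective (toPull f R) := by
  rintro ⟨_, r, hr, rfl⟩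
  exact ⟨⟨r, hr⟩, rfl⟩

theorem funTop_pull (f : Y → X) (R : Subalgebra K (X → K)) :
    funTop (pull f R) = (funTop R).induced f := by
  have h := (PrimeSpectrum.isClosedEmbedding_comap_of_surjective _ (toPull f R).toRingHom
    (toPull_surjective f R)).isInducing.eq_induced
  rw [funTop, h, induced_compose, induced_compose]
  rfl

theorem isClosed_iff {R : Subalgebra K (X → K)} {Z : Set X} :
    IsClosed[funTop R] Z ↔ ∃ S : Set (X → K), S ⊆ R ∧ Z = {x | ∀ p ∈ S, p x = 0} := by
  let := funTop R
  rw [isClosed_induced_iff]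
  constructor
  · rintro ⟨C, hC, rfl⟩
    obtain ⟨S, rfl⟩ := (PrimeSpectrum.isClosed_iff_zeroLocus C).1 hC
    refine ⟨Subtype.val '' S, by rintro _ ⟨p, -, rfl⟩; exact p.2, ?_⟩
    ext x
    simp only [Set.mem_preimage, PrimeSpectrum.mem_zeroLocus, Set.mem_ofPred_eq,
      Set.forall_mem_image]
    rfl
  · rintro ⟨S, hS, rfl⟩
    refine ⟨PrimeSpectrum.zeroLocus (Subtype.val ⁻¹' S), PrimeSpectrum.isClosed_zeroLocus _, ?_⟩
    ext x
    simp only [Set.mem_preimage, PrimeSpectrum.mem_zeroLocus, Set.mem_ofPred_eq]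
    exact ⟨fun h p hp => h (show (⟨p, hS hp⟩ : R) ∈ Subtype.val ⁻¹' S from hp),
      fun h p hp => h p.1 hp⟩

theorem isClosed_zeros {R : Subalgebra K (X → K)} {S : Set (X → K)} (hS : S ⊆ R) :
    IsClosed[funTop R] {x | ∀ p ∈ S, p x = 0} := isClosed_iff.2 ⟨S, hS, rfl⟩

theorem isClosed_zero {R : Subalgebra K (X → K)} {p : X → K} (hp : p ∈ R) :
    IsClosed[funTop R] {x | p x = 0} := by
  simpa using isClosed_zeros (R := R) (S := {p}) (by simpa using hp)

/-- Serves to compare functions on `GL(V)` with and without the inverse of the determinant. -/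
theorem funTop_eq_of_le {P R : Subalgebra K (X → K)} (hPR : P ≤ R)
    (h : ∀ f ∈ R, ∃ g ∈ P, ∀ x, f x = 0 ↔ g x = 0) : funTop P = funTop R := by
  refine TopologicalSpace.ext_iff_isClosed.2 fun Z => ?_
  rw [isClosed_iff, isClosed_iff]
  constructor
  · rintro ⟨S, hS, rfl⟩
    exact ⟨S, hS.trans hPR, rfl⟩
  · rintro ⟨S, hS, rfl⟩
    choose! g hg hfg using h
    refine ⟨g '' S, ?_, ?_⟩
    · rintro _ ⟨p, hp, rfl⟩
      exact hg p (hS hp)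
    · ext x
      simp only [Set.mem_ofPred_eq, Set.forall_mem_image]
      exact forall₂_congr fun p hp => hfg p (hS hp) x

theorem continuous_of_pull_le {P : Subalgebra K (Y → K)} {R : Subalgebra K (X → K)} {f : Y → X}
    (h : pull f R ≤ P) : Continuous[funTop P, funTop R] f := by
  let := funTop P
  let := funTop R
  refine continuous_iff_isClosed.2 fun Z hZ => ?_
  obtain ⟨S, hS, rfl⟩ := isClosed_iff.1 hZ
  refine isClosed_iff.2 ⟨pullHom K f '' S, ?_, ?_⟩
  · rintro _ ⟨p, hp, rfl⟩
    exact h ⟨p, hS hp, rfl⟩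
  · ext x
    simp

theorem pull_adjoin (f : Y → X) (s : Set (X → K)) :
    pull f (Algebra.adjoin K s) = Algebra.adjoin K (pullHom K f '' s) :=
  AlgHom.map_adjoin _ _

theorem isDomain_of_irreducibleSpace (R : Subalgebra K (X → K))
    (h : @IrreducibleSpace X (funTop R)) : IsDomain R := by
  let := funTop R
  have : Nontrivial R := by
    obtain ⟨x⟩ := h.toNonempty
    exact ⟨0, 1, fun h => zero_ne_one (congrFun (congrArg Subtype.val h) x)⟩
  have : NoZeroDivisors R := by
    refine ⟨fun {f g} hfg => ?_⟩
    have hX := isPreirreducible_iff_isClosed_union_isClosed.1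
      (IrreducibleSpace.isIrreducible_univ X).isPreirreducible _ _ (isClosed_zero f.2)
      (isClosed_zero g.2) (fun x _ => by
        have := congrFun (congrArg Subtype.val hfg) x
        exact mul_eq_zero.1 this)
    refine hX.imp (fun h => ?_) (fun h => ?_) <;> ext x <;> exact h (Set.mem_univ x)
  exact { }

theorem irreducibleSpace_of_isDomain (R : Subalgebra K (X → K)) [IsDomain R] :
    @IrreducibleSpace X (funTop R) := by
  let := funTop R
  have hne : Nonempty X := by
    by_contra hX
    rw [not_nonempty_iff] at hX
    exact zero_ne_one (α := R) (Subtype.ext (Subsingleton.elim _ _))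
  suffices h : PreirreducibleSpace X from { toPreirreducibleSpace := h, toNonempty := hne }
  refine ⟨isPreirreducible_iff_isClosed_union_isClosed.2 fun Z W hZ hW hZW => ?_⟩
  obtain ⟨S, hS, rfl⟩ := isClosed_iff.1 hZ
  obtain ⟨T, hT, rfl⟩ := isClosed_iff.1 hW
  by_contra! hc
  simp only [Set.not_subset, Set.mem_univ, true_and, Set.mem_ofPred_eq, not_forall] at hc
  obtain ⟨⟨x, p, hp, hpx⟩, y, q, hq, hqy⟩ := hc
  have h0 : (⟨p, hS hp⟩ * ⟨q, hT hq⟩ : R) = 0 := by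
    ext z
    rcases hZW (Set.mem_univ z) with h | h
    · simp [h p hp]
    · simp [h q hq]
  rcases mul_eq_zero.1 h0 with h | h
  · exact hpx (congrFun (congrArg Subtype.val h) x)
  · exact hqy (congrFun (congrArg Subtype.val h) y)

theorem nonempty_algHom_of_finiteType (K F : Type*) [Field K] [IsAlgClosed K] [Field F]
    [Algebra K F] [Algebra.FiniteType K F] : Nonempty (F →ₐ[K] K) :=
  have : Module.Finite K F := finite_of_finite_type_of_isJacobsonRing K F
  ⟨IsAlgClosed.lift⟩

/-- A set with a finitely generated algebra of functions such that the homomorphisms to `K` are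
the evaluations at the points: an affine variety. -/
structure IsAffine (R : Subalgebra K (X → K)) : Prop where
  fg : R.FG
  point : ∀ φ : R →ₐ[K] K, ∃ x, ∀ f : R, φ f = f.1 x

/-! ### The Nullstellensatz and the dimension of affine varieties. -/

namespace IsAffine

theorem finiteType {R : Subalgebra K (X → K)} (hR : IsAffine R) : Algebra.FiniteType K R :=
  R.fg_iff_finiteType.1 hR.fg

theorem isNoetherianRing {R : Subalgebra K (X → K)} (hR : IsAffine R) : IsNoetherianRing R :=
  have := hR.finiteType
  Algebra.FiniteType.isNoetherianRing K R

theorem noetherianSpace {R : Subalgebra K (X → K)} (hR : IsAffine R) :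
    @TopologicalSpace.NoetherianSpace X (funTop R) :=
  let := funTop R
  have := hR.isNoetherianRing
  Topology.IsInducing.noetherianSpace (i := toSpec R) ⟨rfl⟩

/-- A character of the restricted algebra is evaluation at some `x`. The equations of the range
restrict to zero, so they vanish at `x`, and `x` lies in the range. -/
theorem pull_of_isClosed_range {R : Subalgebra K (X → K)} (hR : IsAffine R) {f : Y → X}
    (hf : IsClosed[funTop R] (Set.range f)) : IsAffine (pull f R) := by
  refine ⟨hR.fg.map _, fun φ => ?_⟩
  obtain ⟨x, hx⟩ := hR.point (φ.comp (toPull f R))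
  obtain ⟨S, hS, hZS⟩ := isClosed_iff.1 hf
  obtain ⟨y, rfl⟩ : x ∈ Set.range f := by
    rw [hZS]
    intro p hp
    change (⟨p, hS hp⟩ : R).1 x = 0
    rw [← hx]
    have : toPull f R ⟨p, hS hp⟩ = 0 := by
      ext y
      have hy := Set.mem_range_self (f := f) y
      rw [hZS] at hy
      exact hy p hp
    simp [this]
  refine ⟨y, fun g => ?_⟩
  obtain ⟨r, rfl⟩ := toPull_surjective _ _ g
  exact hx r

theorem pull_subtype {R : Subalgebra K (X → K)} (hR : IsAffine R) {Z : Set X}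
    (hZ : IsClosed[funTop R] Z) : IsAffine (pull (Subtype.val : Z → X) R) :=
  hR.pull_of_isClosed_range (by rwa [Subtype.range_val])

variable [IsAlgClosed K]

theorem exists_point {R : Subalgebra K (X → K)} (hR : IsAffine R) {I : Ideal R} (hI : I ≠ ⊤) :
    ∃ x, ∀ p ∈ I, p.1 x = 0 := by
  obtain ⟨m, hm, hIm⟩ := Ideal.exists_le_maximal I hI
  have := hR.finiteType
  let : Field (R ⧸ m) := Ideal.Quotient.field m
  obtain ⟨φ⟩ := nonempty_algHom_of_finiteType K (R ⧸ m)
  obtain ⟨x, hx⟩ := hR.point (φ.comp (Ideal.Quotient.mkₐ K m))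
  refine ⟨x, fun p hp => ?_⟩
  rw [← hx p]
  have : Ideal.Quotient.mkₐ K m p = 0 := Ideal.Quotient.eq_zero_iff_mem.2 (hIm hp)
  rw [AlgHom.comp_apply, this, map_zero]

/-- In a Jacobson ring a prime is the intersection of the maximal ideals above it, and here maximal
ideals come from points. -/
theorem exists_point_of_notMem {R : Subalgebra K (X → K)} (hR : IsAffine R) {P : Ideal R}
    [hP : P.IsPrime] {f : R} (hf : f ∉ P) : ∃ x, (∀ p ∈ P, p.1 x = 0) ∧ f.1 x ≠ 0 := by
  have := hR.finiteType
  have hJ : IsJacobsonRing R := isJacobsonRing_of_finiteType (A := K)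
  have h : P.jacobson = P := hJ.out hP.isRadical
  rw [← h, Ideal.jacobson, Submodule.mem_sInf] at hf
  push Not at hf
  obtain ⟨m, ⟨hPm, hm⟩, hfm⟩ := hf
  obtain ⟨x, hx⟩ := hR.exists_point hm.ne_top
  refine ⟨x, fun p hp => hx p (hPm hp), fun h0 => ?_⟩
  have hle : m ≤ RingHom.ker (ev R x) := fun p hp => hx p hp
  rw [hm.eq_of_le (RingHom.ker_ne_top _) hle] at hfm
  exact hfm h0

/-- The points carry the topology induced from the spectrum, which gives one inequality. Conversely,
by the Nullstellensatz the zero sets of primes are irreducible and strictly reverse inclusions. -/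
theorem topologicalKrullDim_eq {R : Subalgebra K (X → K)} (hR : IsAffine R) :
    @topologicalKrullDim X (funTop R) = ringKrullDim R := by
  let := funTop R
  refine le_antisymm ?_ ?_
  · rw [← PrimeSpectrum.topologicalKrullDim_eq_ringKrullDim]
    exact Topology.IsInducing.topologicalKrullDim_le (f := toSpec R) ⟨rfl⟩
  · let Z : PrimeSpectrum R → Set X := fun P => {x | ∀ p ∈ P.asIdeal, p.1 x = 0}
    have hZc : ∀ P, IsClosed (Z P) := fun P => by
      have := isClosed_zeros (R := R) (S := Subtype.val '' (P.asIdeal : Set R))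
        (by rintro _ ⟨p, -, rfl⟩; exact p.2)
      simp only [Set.forall_mem_image] at this
      exact this
    have hZi : ∀ P, IsIrreducible (Z P) := fun P => by
      refine ⟨(hR.exists_point P.2.ne_top), isPreirreducible_iff_isClosed_union_isClosed.2
        fun C D hC hD hCD => ?_⟩
      obtain ⟨S, hS, rfl⟩ := isClosed_iff.1 hC
      obtain ⟨T, hT, rfl⟩ := isClosed_iff.1 hD
      by_contra! hc
      simp only [Set.not_subset, Set.mem_ofPred_eq, not_forall] at hc
      obtain ⟨⟨x, hxP, p, hp, hpx⟩, y, hyP, q, hq, hqy⟩ := hc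
      have hpP : (⟨p, hS hp⟩ : R) ∉ P.asIdeal := fun h => hpx (hxP _ h)
      have hqP : (⟨q, hT hq⟩ : R) ∉ P.asIdeal := fun h => hqy (hyP _ h)
      obtain ⟨z, hz, hzpq⟩ := hR.exists_point_of_notMem (P := P.asIdeal)
        (fun h => (P.2.mem_or_mem h).elim hpP hqP : (⟨p, hS hp⟩ * ⟨q, hT hq⟩ : R) ∉ P.asIdeal)
      apply hzpq
      rcases hCD hz with h | h
      · simp [h p hp]
      · simp [h q hq]
    let F : (PrimeSpectrum R)ᵒᵈ → TopologicalSpace.IrreducibleCloseds X := fun P =>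
      ⟨Z (OrderDual.ofDual P), hZi _, hZc _⟩
    have hF : StrictMono F := by
      intro P Q hPQ
      change (OrderDual.ofDual Q).asIdeal < (OrderDual.ofDual P).asIdeal at hPQ
      obtain ⟨hle, f, hfP, hfQ⟩ := SetLike.lt_iff_le_and_exists.1 hPQ
      obtain ⟨x, hx, hfx⟩ := hR.exists_point_of_notMem hfQ
      refine lt_of_le_not_ge (fun y hy p hp => hy p (hle hp)) fun hge => ?_
      exact hfx (hge hx f hfP)
    rw [ringKrullDim, ← Order.krullDim_orderDual]
    exact Order.krullDim_le_of_strictMono F hF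

end IsAffine

/-! ### Products with affine spaces -/

/-- Polynomials over an algebra of functions on `X`, as functions on `X × (σ → K)`. -/
noncomputable def prodHom (R : Subalgebra K (X → K)) (σ : Type*) :
    MvPolynomial σ R →ₐ[K] (X × (σ → K) → K) :=
  AlgHom.pi fun z => aevalTower (ev R z.1) z.2

theorem prodHom_apply (R : Subalgebra K (X → K)) (σ : Type*) (P : MvPolynomial σ R)
    (z : X × (σ → K)) : prodHom R σ P z = aevalTower (ev R z.1) z.2 P := rfl

/-- The algebra of functions on `X × (σ → K)` generated by the functions on `X` and the
coordinates. -/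
noncomputable def prodAlg (R : Subalgebra K (X → K)) (σ : Type*) : Subalgebra K (X × (σ → K) → K) :=
  (prodHom R σ).range

theorem prodHom_injective [Infinite K] (R : Subalgebra K (X → K)) (σ : Type*) :
    Function.Injective (prodHom R σ) := by
  refine (injective_iff_map_eq_zero _).2 fun P hP => ?_
  ext m x
  have h : P.map (ev R x : R →+* K) = 0 := by
    refine MvPolynomial.funext fun c => ?_
    have := congrFun hP (x, c)
    rw [MvPolynomial.eval_map, map_zero]
    exact this
  have := congrArg (coeff m) h
  simpa [coeff_map] using this

theorem comp_fst_mem_prodAlg {R : Subalgebra K (X → K)} {σ : Type*} {p : X → K} (hp : p ∈ R) :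
    (fun z : X × (σ → K) => p z.1) ∈ prodAlg R σ :=
  ⟨C ⟨p, hp⟩, by ext z; simp [prodHom_apply]⟩

theorem coord_mem_prodAlg (R : Subalgebra K (X → K)) {σ : Type*} (i : σ) :
    (fun z : X × (σ → K) => z.2 i) ∈ prodAlg R σ :=
  ⟨MvPolynomial.X i, by ext z; simp [prodHom_apply]⟩

theorem pull_prodAlg_le {R : Subalgebra K (X → K)} {σ : Type*} {P : Subalgebra K (Y → K)}
    {f : Y → X × (σ → K)} (h1 : pull (fun y => (f y).1) R ≤ P)
    (h2 : ∀ i, (fun y => (f y).2 i) ∈ P) : pull f (prodAlg R σ) ≤ P := by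
  rintro _ ⟨_, ⟨p, rfl⟩, rfl⟩
  induction p using MvPolynomial.induction_on with
  | C a =>
    convert h1 ⟨a.1, a.2, rfl⟩ using 1
    ext y
    simp [prodHom_apply]
  | add p q hp hq =>
    change pullHom K f (prodHom R σ (p + q)) ∈ P
    rw [map_add, map_add]
    exact P.add_mem hp hq
  | mul_X p i hp =>
    change pullHom K f (prodHom R σ (p * MvPolynomial.X i)) ∈ P
    rw [map_mul, map_mul]
    refine P.mul_mem hp ?_
    convert h2 i using 1
    ext y
    simp [prodHom_apply]

theorem isAffine_prodAlg {R : Subalgebra K (X → K)} (hR : IsAffine R) (σ : Type*) [Finite σ] :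
    IsAffine (prodAlg R σ) := by
  have := hR.finiteType
  have : Algebra.FiniteType K (MvPolynomial σ R) :=
    Algebra.FiniteType.trans (S := R) inferInstance inferInstance
  refine ⟨?_, fun φ => ?_⟩
  · rw [prodAlg, ← Algebra.map_top]
    exact this.out.map _
  · let ψ := φ.comp (prodHom R σ).rangeRestrict
    obtain ⟨x, hx⟩ := hR.point (ψ.comp (IsScalarTower.toAlgHom K R (MvPolynomial σ R)))
    refine ⟨(x, fun i => ψ (MvPolynomial.X i)), ?_⟩
    rintro ⟨_, p, rfl⟩
    change ψ p = aevalTower (ev R x) (fun i => ψ (MvPolynomial.X i)) p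
    induction p using MvPolynomial.induction_on with
    | C a => simpa using hx a
    | add p q hp hq => rw [map_add, map_add, hp, hq]
    | mul_X p i hp => rw [map_mul, map_mul, hp]; simp

theorem isDomain_prodAlg [Infinite K] (R : Subalgebra K (X → K)) [IsDomain R] (σ : Type*) :
    IsDomain (prodAlg R σ) :=
  (AlgEquiv.ofInjective _ (prodHom_injective R σ)).symm.toMulEquiv.isDomain _

theorem ringKrullDim_prodAlg [Infinite K] {R : Subalgebra K (X → K)} (hR : IsAffine R)
    (σ : Type*) [Finite σ] : ringKrullDim (prodAlg R σ) = ringKrullDim R + Nat.card σ := by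
  have := hR.isNoetherianRing
  rw [← MvPolynomial.ringKrullDim_of_isNoetherianRing]
  exact (ringKrullDim_eq_of_ringEquiv
    (AlgEquiv.ofInjective _ (prodHom_injective R σ)).toRingEquiv).symm

/-! ### The dimension of the fibres of a morphism -/

/-- The inclusion `A ≤ R` stands for a dominant morphism, with fibres the sets on which all
functions of `A` are constant. By generic normalization, each fibre over `h ≠ 0` is finite and
surjective over affine `d`-space. -/
theorem exists_dim_fiber [IsAlgClosed K] {R A : Subalgebra K (X → K)} (hR : IsAffine R)
    [IsDomain R] (hA : A ≤ R) (hAfg : A.FG) :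
    ∃ (a d : ℕ) (h : X → K), h ∈ A ∧ h ≠ 0 ∧ ringKrullDim A = a ∧
      ringKrullDim R = (a + d : ℕ) ∧ ∀ x, h x ≠ 0 →
        letI := funTop R
        topologicalKrullDim {x' | ∀ p ∈ A, p x' = p x} = d := by
  have hRft := hR.finiteType
  have hAft : Algebra.FiniteType K A := A.fg_iff_finiteType.1 hAfg
  let : Algebra A R := (Subalgebra.inclusion hA).toAlgebra
  have : IsScalarTower K A R := IsScalarTower.of_algebraMap_eq fun _ => rfl
  have hinj : Function.Injective (algebraMap A R) := Subalgebra.inclusion_injective hA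
  have : FaithfulSMul A R := (faithfulSMul_iff_algebraMap_injective A R).2 hinj
  have : IsDomain A := hinj.isDomain
  have : Algebra.FiniteType A R := Algebra.FiniteType.of_restrictScalars_finiteType K A R
  obtain ⟨a, u, hu, hua⟩ := exists_noether_normalization K A
  obtain ⟨d, t, h, ht, h0, hint⟩ := exists_generic_noether_normalization A R
  have htb : IsTranscendenceBasis A t := isTranscendenceBasis_of_isIntegral ht fun b => by
    obtain ⟨N, hN⟩ := hint b
    exact ⟨h ^ N, pow_ne_zero _ h0, by simpa using hN⟩
  refine ⟨a, d, h.1, h.2, fun h' => h0 (Subtype.ext h'), hua, ?_, fun x hx => ?_⟩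
  · rw [ringKrullDim_eq_card_of_isTranscendenceBasis (hu.sumElim_comp htb)]
    simp [add_comm]
  set F : Set X := {x' | ∀ p ∈ A, p x' = p x} with hF
  have hFc : IsClosed[funTop R] F := by
    have := isClosed_zeros (R := R) (S := (fun p : X → K => p - algebraMap K (X → K) (p x)) '' A)
      (by
        rintro _ ⟨p, hp, rfl⟩
        exact R.sub_mem (hA hp) (R.algebraMap_mem _))
    convert this using 1
    ext x'
    simp [hF, sub_eq_zero]
  have hFa := hR.pull_subtype hFc
  have hdim := hFa.topologicalKrullDim_eq
  rw [funTop_pull] at hdim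
  refine hdim.trans ?_
  let ρ := toPull (Subtype.val : F → X) R
  let tF : Fin d → pull (Subtype.val : F → X) R := fun i => ρ (t i)
  have hcomp : (ρ.toRingHom.comp (aeval t : MvPolynomial (Fin d) A →ₐ[A] R).toRingHom) =
      (aeval tF : MvPolynomial (Fin d) K →ₐ[K] _).toRingHom.comp
        (MvPolynomial.map (ev A x : A →+* K)) := by
    apply MvPolynomial.ringHom_ext
    · intro p
      ext y
      simpa [ρ] using! y.2 p.1 p.2
    · intro i
      simp [tF]
  have hpt : ∀ c : Fin d → K, ∃ y : F, ∀ i, (t i).1 y = c i := by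
    intro c
    obtain ⟨I, hI, h1, h2⟩ := exists_ideal_ne_top_over (ev A x : A →+* K) ht
      (by simpa using hx) hint c
    obtain ⟨y, hy⟩ := hR.exists_point hI
    refine ⟨⟨y, fun p hp => ?_⟩, fun i => ?_⟩
    · have := hy _ (h1 ((⟨p, hp⟩ : A) - algebraMap K A (p x)) (sub_self (p x)))
      exact sub_eq_zero.1 this
    · have := hy _ (h2 i (algebraMap K A (c i)) rfl)
      exact sub_eq_zero.1 this
  -- On the fibre the parameters take all values in `K^d`, so a polynomial relation among them
  -- vanishes identically.
  have hind : AlgebraicIndependent K tF := by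
    refine (injective_iff_map_eq_zero _).2 fun P hP => MvPolynomial.funext fun c => ?_
    obtain ⟨y, hy⟩ := hpt c
    have := congrArg (ev _ y) hP
    rw [← AlgHom.comp_apply, MvPolynomial.comp_aeval, map_zero] at this
    rw [map_zero, ← this, MvPolynomial.aeval_eq_eval]
    congr 2
    ext i
    exact (hy i).symm
  rw [ringKrullDim_eq_card_of_isIntegral hind]
  · simp
  intro y
  obtain ⟨b, rfl⟩ := toPull_surjective _ _ y
  obtain ⟨N, p, hp, hpb⟩ := hint b
  have h1 : (aeval tF : MvPolynomial (Fin d) K →ₐ[K] _).toRingHom.IsIntegralElem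
      (ρ (algebraMap A R h ^ N * b)) := by
    refine ⟨p.map (MvPolynomial.map (ev A x : A →+* K)), hp.map _, ?_⟩
    rw [Polynomial.eval₂_map, ← hcomp]
    have := congrArg ρ.toRingHom hpb
    rwa [Polynomial.hom_eval₂, map_zero] at this
  have h2 : ρ (algebraMap A R h) = algebraMap K _ (h.1 x) := by
    ext y
    exact y.2 h.1 h.2
  -- On the fibre `h` is the nonzero constant `h x`, so the factor `h ^ N` can be cancelled.
  have h3 := (RingHom.isIntegralElem_map (f := (aeval tF : MvPolynomial (Fin d) K →ₐ[K]
    pull (Subtype.val : F → X) R).toRingHom) (x := C ((h.1 x)⁻¹ ^ N))).mul _ h1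
  convert! h3 using 1
  rw [map_mul ρ, map_pow ρ, h2, ← mul_assoc]
  simp only [AlgHom.toRingHom_eq_coe, RingHom.coe_coe, aeval_C]
  rw [← map_pow, ← map_mul, ← mul_pow, inv_mul_cancel₀ hx]
  simp [ρ]

end FunAlg

/-! ### Polynomial maps to vector spaces, and the general linear group -/

namespace FunAlg

open Multialg Module
open scoped Topology

variable {K : Type*} [Field K] {X Y : Type*}
  {V W U : Type*} [AddCommGroup V] [Module K V] [AddCommGroup W] [Module K W]
  [AddCommGroup U] [Module K U]

theorem zariski_eq_funTop : zariski K V = funTop (polyFun K V) := by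
  refine TopologicalSpace.ext_iff_isClosed.2 fun Z => ?_
  rw [isClosed_zariski_iff, isClosed_iff]
  rfl

/-- A map to a vector space whose coordinates belong to the given algebra of functions. -/
def IsPolyMap (R : Subalgebra K (X → K)) (f : X → V) : Prop :=
  ∀ l : Dual K V, (fun x => l (f x)) ∈ R

namespace IsPolyMap

theorem id : IsPolyMap (polyFun K V) (fun v : V => v) := fun l => Algebra.subset_adjoin ⟨l, rfl⟩

variable {R : Subalgebra K (X → K)}

theorem const (v : V) : IsPolyMap R (fun _ => v) := fun l => R.algebraMap_mem (l v)

theorem add {f g : X → V} (hf : IsPolyMap R f) (hg : IsPolyMap R g) :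
    IsPolyMap R (fun x => f x + g x) := fun l => by
  simpa using! R.add_mem (hf l) (hg l)

theorem sub {f g : X → V} (hf : IsPolyMap R f) (hg : IsPolyMap R g) :
    IsPolyMap R (fun x => f x - g x) := fun l => by
  simpa using! R.sub_mem (hf l) (hg l)

theorem smul {p : X → K} {f : X → V} (hp : p ∈ R) (hf : IsPolyMap R f) :
    IsPolyMap R (fun x => p x • f x) := fun l => by
  simpa using! R.mul_mem hp (hf l)

theorem sum {ι : Type*} {s : Finset ι} {f : ι → X → V} (hf : ∀ i ∈ s, IsPolyMap R (f i)) :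
    IsPolyMap R (fun x => ∑ i ∈ s, f i x) := fun l => by
  convert R.sum_mem fun i hi => hf i hi l using 1
  ext x
  simp

theorem linear {f : X → V} (hf : IsPolyMap R f) (m : V →ₗ[K] W) :
    IsPolyMap R (fun x => m (f x)) := fun l => hf (l.comp m)

theorem of_mem {f : X → K} (hf : f ∈ R) : IsPolyMap R f := fun l => by
  have : (fun x => l (f x)) = l 1 • f := by
    ext x
    have := l.map_smul (f x) 1
    simp only [smul_eq_mul, mul_one] at this
    simp [this, mul_comm]
  rw [this]
  exact R.smul_mem hf _

theorem comp {f : X → V} (hf : IsPolyMap R f) (g : Y → X) :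
    IsPolyMap (pull g R) (fun y => f (g y)) := fun l => ⟨_, hf l, rfl⟩

theorem pull_le {f : X → V} (hf : IsPolyMap R f) : pull f (polyFun K V) ≤ R := by
  rw [polyFun, pull_adjoin]
  refine Algebra.adjoin_le ?_
  rintro _ ⟨_, ⟨l, rfl⟩, rfl⟩
  exact hf l

theorem comp_mem {f : X → V} (hf : IsPolyMap R f) {p : V → K} (hp : p ∈ polyFun K V) :
    (fun x => p (f x)) ∈ R := hf.pull_le ⟨p, hp, rfl⟩

theorem pi {ι : Type*} [Finite ι] {f : X → ι → V} (hf : ∀ i, IsPolyMap R (fun x => f x i)) :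
    IsPolyMap R f := fun l => by
  have := Fintype.ofFinite ι
  classical
  have h := sum (s := Finset.univ) fun i (_ : i ∈ Finset.univ) =>
    (hf i).linear (LinearMap.single K (fun _ => V) i)
  convert h l using 3 with x
  exact (LinearMap.sum_single_apply (fun _ => V) (f x)).symm

theorem prodMk {f : X → V} {g : X → W} (hf : IsPolyMap R f) (hg : IsPolyMap R g) :
    IsPolyMap R (fun x => (f x, g x)) := by
  convert (hf.linear (LinearMap.inl K V W)).add (hg.linear (LinearMap.inr K V W)) using 2
  simp

theorem bilinear [FiniteDimensional K V] {f : X → V} {g : X → W} (hf : IsPolyMap R f)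
    (hg : IsPolyMap R g) (m : V →ₗ[K] W →ₗ[K] U) : IsPolyMap R (fun x => m (f x) (g x)) := by
  let b := Module.finBasis K V
  have h := sum (s := Finset.univ) fun i (_ : i ∈ Finset.univ) =>
    (hg.linear (m (b i))).smul (hf (b.coord i))
  convert h using 2 with x
  conv_lhs => rw [← b.sum_repr (f x)]
  rw [map_sum, LinearMap.sum_apply]
  refine Finset.sum_congr rfl fun i _ => ?_
  rw [map_smul, LinearMap.smul_apply]
  rfl

theorem multilinear [FiniteDimensional K V] {ι : Type*} [Fintype ι] {f : ι → X → V}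
    (hf : ∀ i, IsPolyMap R (f i)) (m : MultilinearMap K (fun _ : ι => V) W) :
    IsPolyMap R (fun x => m (fun i => f i x)) := by
  classical
  let b := Module.finBasis K V
  have h := sum (s := Finset.univ) fun (r : ι → Fin (finrank K V)) (_ : r ∈ Finset.univ) =>
    (const (R := R) (m fun i => b (r i))).smul
      (R.prod_mem (t := Finset.univ) fun i _ => hf i (b.coord (r i)))
  convert h using 2 with x
  have : (fun i => f i x) = fun i => ∑ j, b.repr (f i x) j • b j := by
    ext i
    exact (b.sum_repr (f i x)).symm
  rw [this, MultilinearMap.map_sum]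
  refine Finset.sum_congr rfl fun r _ => ?_
  rw [MultilinearMap.map_smul_univ]
  simp

theorem isClosed_eq [FiniteDimensional K V] {f g : X → V} (hf : IsPolyMap R f)
    (hg : IsPolyMap R g) : IsClosed[funTop R] {x | f x = g x} := by
  have := isClosed_zeros (R := R) (S := Set.range fun (l : Dual K V) x => l (f x - g x))
    (by rintro _ ⟨l, rfl⟩; exact hf.sub hg l)
  convert this using 1
  ext x
  simp only [Set.mem_ofPred_eq, Set.forall_mem_range]
  rw [Module.forall_dual_apply_eq_zero_iff, sub_eq_zero]

theorem det_mem {ι : Type*} [Fintype ι] [DecidableEq ι] {M : X → Matrix ι ι K}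
    (hM : ∀ i j, (fun x => M x i j) ∈ R) : (fun x => (M x).det) ∈ R := by
  have : (fun x => (M x).det) = ∑ σ : Equiv.Perm ι, Equiv.Perm.sign σ •
      ∏ i, fun x => M x (σ i) i := by
    ext x
    simp [Matrix.det_apply]
  rw [this]
  exact R.sum_mem fun σ _ => by
    rcases Int.units_eq_one_or (Equiv.Perm.sign σ) with h | h
    · rw [h, one_smul]; exact R.prod_mem fun i _ => hM _ _
    · rw [h, Units.neg_smul, one_smul]; exact R.neg_mem (R.prod_mem fun i _ => hM _ _)

end IsPolyMap

theorem continuous_zariski_of_isPolyMap {R : Subalgebra K (X → K)} {f : X → V}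
    (hf : IsPolyMap R f) : Continuous[funTop R, zariski K V] f := by
  rw [zariski_eq_funTop]
  exact continuous_of_pull_le hf.pull_le

theorem isAffine_polyFun [FiniteDimensional K V] : IsAffine (polyFun K V) := by
  let b := Module.finBasis K V
  refine ⟨?_, fun φ => ?_⟩
  · refine Subalgebra.fg_def.2 ⟨Set.range fun i => (b.coord i : V → K), Set.finite_range _, ?_⟩
    refine le_antisymm (Algebra.adjoin_le ?_) (Algebra.adjoin_le ?_)
    · rintro _ ⟨i, rfl⟩
      exact Algebra.subset_adjoin ⟨b.coord i, rfl⟩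
    · rintro _ ⟨l, rfl⟩
      have : (fun v => l v) = ∑ i, l (b i) • (b.coord i : V → K) := by
        ext v
        conv_lhs => rw [← b.sum_repr v]
        rw [map_sum, Finset.sum_apply]
        refine Finset.sum_congr rfl fun i _ => ?_
        rw [map_smul, smul_eq_mul, mul_comm]
        rfl
      change (fun v => l v) ∈ _
      rw [this]
      exact Subalgebra.sum_mem _ fun i _ => Subalgebra.smul_mem _
        (Algebra.subset_adjoin (Set.mem_range_self i)) _
  · let m : Dual K V →ₗ[K] polyFun K V :=
      { toFun := fun l => ⟨fun v => l v, IsPolyMap.id l⟩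
        map_add' := fun _ _ => rfl
        map_smul' := fun _ _ => rfl }
    let v := (Module.evalEquiv K V).symm (φ.toLinearMap.comp m)
    have hv : ∀ l : Dual K V, l v = φ (m l) := fun l => by
      simp [v]
    refine ⟨v, fun f => ?_⟩
    have h : φ = ev (polyFun K V) v := by
      have htop : (Algebra.adjoin K (Set.range fun l : Dual K V => m l)) = ⊤ := by
        rw [eq_top_iff]
        rintro ⟨p, hp⟩ -
        induction hp using Algebra.adjoin_induction with
        | mem x hx =>
          obtain ⟨l, rfl⟩ := hx
          exact Algebra.subset_adjoin ⟨l, rfl⟩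
        | algebraMap r => exact Subalgebra.algebraMap_mem _ r
        | add x y hx hy h1 h2 => exact Subalgebra.add_mem _ h1 h2
        | mul x y hx hy h1 h2 => exact Subalgebra.mul_mem _ h1 h2
      refine AlgHom.ext_of_adjoin_eq_top htop ?_
      rintro _ ⟨l, rfl⟩
      exact (hv l).symm
    rw [h]
    rfl

/-! #### The general linear group -/

variable (K V) in
/-- The algebra of functions on `GL(V)` generated by the entries of a matrix and of its inverse. -/
def glAlg : Subalgebra K ((V ≃ₗ[K] V) → K) :=
  pull (fun g : V ≃ₗ[K] V => ((g : V →ₗ[K] V), ((g⁻¹ : V ≃ₗ[K] V) : V →ₗ[K] V)))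
    (polyFun K ((V →ₗ[K] V) × (V →ₗ[K] V)))

theorem isPolyMap_coe : IsPolyMap (glAlg K V) (fun g : V ≃ₗ[K] V => (g : V →ₗ[K] V)) :=
  ((IsPolyMap.id (K := K) (V := (V →ₗ[K] V) × (V →ₗ[K] V))).comp _).linear (LinearMap.fst K _ _)

theorem isPolyMap_inv :
    IsPolyMap (glAlg K V) (fun g : V ≃ₗ[K] V => ((g⁻¹ : V ≃ₗ[K] V) : V →ₗ[K] V)) :=
  ((IsPolyMap.id (K := K) (V := (V →ₗ[K] V) × (V →ₗ[K] V))).comp _).linear (LinearMap.snd K _ _)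

theorem pull_glAlg_le {R : Subalgebra K (X → K)} {f : X → V ≃ₗ[K] V}
    (h1 : IsPolyMap R fun x => (f x : V →ₗ[K] V))
    (h2 : IsPolyMap R fun x => (((f x)⁻¹ : V ≃ₗ[K] V) : V →ₗ[K] V)) :
    pull f (glAlg K V) ≤ R := by
  rw [glAlg, pull_pull]
  exact (h1.prodMk h2).pull_le

theorem pull_mul_left_le (g : V ≃ₗ[K] V) : pull (fun h => g * h) (glAlg K V) ≤ glAlg K V :=
  pull_glAlg_le (isPolyMap_coe.linear (LinearMap.mulLeft K (g : Module.End K V)))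
    (by
      simp only [mul_inv_rev]
      exact isPolyMap_inv.linear (LinearMap.mulRight K ((g⁻¹ : V ≃ₗ[K] V) : Module.End K V)))

theorem pull_mul_right_le (g : V ≃ₗ[K] V) : pull (fun h => h * g) (glAlg K V) ≤ glAlg K V :=
  pull_glAlg_le (isPolyMap_coe.linear (LinearMap.mulRight K (g : Module.End K V)))
    (by
      simp only [mul_inv_rev]
      exact isPolyMap_inv.linear (LinearMap.mulLeft K ((g⁻¹ : V ≃ₗ[K] V) : Module.End K V)))

theorem pull_inv_le : pull (fun h => h⁻¹) (glAlg K V) ≤ glAlg K V :=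
  pull_glAlg_le isPolyMap_inv (by simpa only [inv_inv] using isPolyMap_coe)

/-- `GL(V)` is identified with the closed set of pairs `(p, q)` such that `p q = q p = 1`. -/
theorem isAffine_glAlg [FiniteDimensional K V] : IsAffine (glAlg K V) := by
  refine isAffine_polyFun.pull_of_isClosed_range ?_
  have h1 : IsPolyMap (polyFun K ((V →ₗ[K] V) × (V →ₗ[K] V)))
      (fun p => (p.1 : Module.End K V)) :=
    (IsPolyMap.id (K := K) (V := (V →ₗ[K] V) × (V →ₗ[K] V))).linear (LinearMap.fst K _ _)
  have h2 : IsPolyMap (polyFun K ((V →ₗ[K] V) × (V →ₗ[K] V)))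
      (fun p => (p.2 : Module.End K V)) :=
    (IsPolyMap.id (K := K) (V := (V →ₗ[K] V) × (V →ₗ[K] V))).linear (LinearMap.snd K _ _)
  have h := ((h1.bilinear h2 (LinearMap.mul K (Module.End K V))).prodMk
    (h2.bilinear h1 (LinearMap.mul K (Module.End K V)))).isClosed_eq (IsPolyMap.const (1, 1))
  convert h using 1
  ext ⟨p, q⟩
  simp only [Set.mem_range, Set.mem_ofPred_eq, Prod.mk.injEq, LinearMap.mul_apply']
  constructor
  · rintro ⟨g, rfl, rfl⟩
    constructor <;> ext v
    · exact g.apply_symm_apply v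
    · exact g.symm_apply_apply v
  · rintro ⟨h1, h2⟩
    exact ⟨LinearEquiv.ofLinearMap p q h1 h2, rfl, rfl⟩

/-- By the adjugate formula, the inverse times the determinant is polynomial in the matrix entries.
-/
theorem exists_det_pow_mul_mem [FiniteDimensional K V] {f : (V ≃ₗ[K] V) → K}
    (hf : f ∈ glAlg K V) : ∃ (N : ℕ) (p : (V ≃ₗ[K] V) → K),
      p ∈ pull (fun g : V ≃ₗ[K] V => (g : V →ₗ[K] V)) (polyFun K (V →ₗ[K] V)) ∧
      ∀ g : V ≃ₗ[K] V, LinearMap.det (g : V →ₗ[K] V) ^ N * f g = p g := by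
  set P := pull (fun g : V ≃ₗ[K] V => (g : V →ₗ[K] V)) (polyFun K (V →ₗ[K] V)) with hP
  have hid : IsPolyMap P (fun g : V ≃ₗ[K] V => (g : V →ₗ[K] V)) := IsPolyMap.id.comp _
  let b := Module.finBasis K V
  let M : (V ≃ₗ[K] V) → Matrix _ _ K := fun g => LinearMap.toMatrix b b (g : V →ₗ[K] V)
  have hM : ∀ i j, (fun g => M g i j) ∈ P := fun i j =>
    hid ((Matrix.entryLinearMap K K i j).comp (LinearMap.toMatrix b b).toLinearMap)
  have hdet : (fun g : V ≃ₗ[K] V => LinearMap.det (g : V →ₗ[K] V)) ∈ P := by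
    simpa only [← LinearMap.det_toMatrix b] using IsPolyMap.det_mem hM
  have hadj : ∀ i j, (fun g => (M g).adjugate i j) ∈ P := fun i j => by
    simp only [Matrix.adjugate_apply]
    refine IsPolyMap.det_mem fun k l => ?_
    by_cases hk : k = j
    · simp only [hk, Matrix.updateRow_self]
      exact P.algebraMap_mem _
    · simpa only [Matrix.updateRow_ne hk] using hM k l
  have hadj' : IsPolyMap P (fun g => (M g).adjugate) := by
    have := IsPolyMap.pi (R := P) (f := fun g => (M g).adjugate) fun i =>
      IsPolyMap.pi fun j => IsPolyMap.of_mem (hadj i j)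
    exact this
  have hinv : IsPolyMap P (fun g : V ≃ₗ[K] V => LinearMap.det (g : V →ₗ[K] V) •
      ((g⁻¹ : V ≃ₗ[K] V) : V →ₗ[K] V)) := by
    convert hadj'.linear (Matrix.toLin b b).toLinearMap using 2 with g
    have h1 : (Matrix.toLin b b) (M g).adjugate ∘ₗ (g : V →ₗ[K] V) =
        LinearMap.det (g : V →ₗ[K] V) • LinearMap.id := by
      have h2 : (g : V →ₗ[K] V) = Matrix.toLin b b (M g) := by simp [M]
      conv_lhs => rw [h2]
      rw [← Matrix.toLin_mul, Matrix.adjugate_mul, map_smul, Matrix.toLin_one]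
      simp [M]
    ext v
    have := LinearMap.congr_fun h1 (g⁻¹ v)
    simp only [LinearMap.comp_apply, LinearEquiv.coe_coe, LinearMap.smul_apply,
      LinearMap.id_apply] at this
    have h3 : g (g⁻¹ v) = v := g.apply_symm_apply v
    rw [h3] at this
    exact this.symm
  rw [glAlg, polyFun, pull_adjoin] at hf
  induction hf using Algebra.adjoin_induction with
  | mem f hf =>
    obtain ⟨_, ⟨l, rfl⟩, rfl⟩ := hf
    refine ⟨1, _, P.add_mem (P.mul_mem hdet (hid (l.comp (LinearMap.inl K _ _))))
      (hinv (l.comp (LinearMap.inr K _ _))), fun g => ?_⟩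
    have : ((g : V →ₗ[K] V), ((g⁻¹ : V ≃ₗ[K] V) : V →ₗ[K] V)) =
      LinearMap.inl K _ _ (g : V →ₗ[K] V) +
        LinearMap.inr K _ _ ((g⁻¹ : V ≃ₗ[K] V) : V →ₗ[K] V) := by simp
    simp only [pullHom_apply, this, map_add, pow_one, mul_add, Pi.add_apply, Pi.mul_apply,
      map_smul, smul_eq_mul, LinearMap.comp_apply]
  | algebraMap c => exact ⟨0, _, P.algebraMap_mem c, by simp⟩
  | add f₁ f₂ h₁ h₂ ih₁ ih₂ =>
    obtain ⟨N, p, hp, hpf⟩ := ih₁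
    obtain ⟨N', p', hp', hpf'⟩ := ih₂
    refine ⟨N + N', _, P.add_mem (P.mul_mem (P.pow_mem hdet N') hp)
      (P.mul_mem (P.pow_mem hdet N) hp'), fun g => ?_⟩
    simp only [Pi.add_apply, Pi.mul_apply, Pi.pow_apply, ← hpf, ← hpf']
    ring
  | mul f₁ f₂ h₁ h₂ ih₁ ih₂ =>
    obtain ⟨N, p, hp, hpf⟩ := ih₁
    obtain ⟨N', p', hp', hpf'⟩ := ih₂
    refine ⟨N + N', _, P.mul_mem hp hp', fun g => ?_⟩
    simp only [Pi.mul_apply, ← hpf, ← hpf']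
    ring

theorem zariskiGL_eq_funTop [FiniteDimensional K V] : zariskiGL K V = funTop (glAlg K V) := by
  rw [zariskiGL, zariski_eq_funTop, ← funTop_pull]
  refine funTop_eq_of_le isPolyMap_coe.pull_le fun f hf => ?_
  obtain ⟨N, p, hp, hpf⟩ := exists_det_pow_mul_mem hf
  refine ⟨p, hp, fun g => ?_⟩
  rw [← hpf, mul_eq_zero, or_iff_right]
  exact pow_ne_zero _ (LinearEquiv.isUnit_det' g).ne_zero

end FunAlg

/-! ### Irreducible sets and dimension of finite unions -/

namespace FunAlg

open Topology TopologicalSpace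

theorem isIrreducible_of_image {X Y : Type*} [TopologicalSpace X] [TopologicalSpace Y] {f : X → Y}
    (hf : IsInducing f) {s : Set X} (hs : IsIrreducible (f '' s)) : IsIrreducible s := by
  refine ⟨hs.nonempty.of_image, isPreirreducible_iff_isClosed_union_isClosed.2
    fun A B hA hB hAB => ?_⟩
  obtain ⟨A', hA', rfl⟩ := hf.isClosed_iff.1 hA
  obtain ⟨B', hB', rfl⟩ := hf.isClosed_iff.1 hB
  have := isPreirreducible_iff_isClosed_union_isClosed.1 hs.isPreirreducible A' B' hA' hB'
    (Set.image_subset_iff.2 hAB)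
  simpa only [Set.image_subset_iff] using this

theorem exists_subset_of_isIrreducible {X ι : Type*} [TopologicalSpace X] [Finite ι]
    {Z : ι → Set X} (hZ : ∀ i, IsClosed (Z i)) {C : Set X} (hC : IsIrreducible C)
    (hCZ : C ⊆ ⋃ i, Z i) : ∃ i, C ⊆ Z i := by
  have h := isIrreducible_iff_sUnion_isClosed.1 hC (Set.finite_range Z).toFinset
    (by simpa using hZ) (by simpa using! hCZ)
  simpa using h

theorem components_iUnion {X ι : Type*} (τ : TopologicalSpace X) [Finite ι]
    {Z : ι → Set X} (hZ : ∀ i, IsClosed[τ] (Z i)) (hi : ∀ i, @IsIrreducible X τ (Z i)) :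
    Multialg.components τ (⋃ i, Z i) = {C | Maximal (fun Y => Y ∈ Set.range Z) C} := by
  set S := ⋃ i, Z i with hS
  have himg : ∀ i, Subtype.val '' (Subtype.val ⁻¹' Z i : Set S) = Z i := fun i => by
    rw [Subtype.image_preimage_coe, Set.inter_eq_right]
    exact Set.subset_iUnion Z i
  have hirr : ∀ i, IsIrreducible (Subtype.val ⁻¹' Z i : Set S) := fun i =>
    isIrreducible_of_image IsInducing.subtypeVal (by rw [himg]; exact hi i)
  have hsub : ∀ C : Set S, IsIrreducible C → ∃ i, C ⊆ Subtype.val ⁻¹' Z i := fun C hC => by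
    obtain ⟨i, h⟩ := exists_subset_of_isIrreducible hZ
      (hC.image Subtype.val continuous_subtype_val.continuousOn)
      (by rintro _ ⟨x, -, rfl⟩; exact x.2)
    exact ⟨i, Set.image_subset_iff.1 h⟩
  ext C
  constructor
  · rintro ⟨C, hC, rfl⟩
    obtain ⟨i, hCi⟩ := hsub C hC.1
    have h1 : C = Subtype.val ⁻¹' Z i := hCi.antisymm (hC.2 (hirr i) hCi)
    subst h1
    change Maximal _ (Subtype.val '' (Subtype.val ⁻¹' Z i : Set S))
    rw [himg]
    refine ⟨⟨i, rfl⟩, ?_⟩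
    rintro _ ⟨j, rfl⟩ hij
    have h2 := Set.image_mono (f := Subtype.val) (hC.2 (hirr j) (Set.preimage_mono hij))
    rwa [himg, himg] at h2
  · rintro ⟨⟨i, rfl⟩, hmax⟩
    refine ⟨Subtype.val ⁻¹' Z i, ⟨hirr i, fun D hD hiD => ?_⟩, himg i⟩
    obtain ⟨j, hDj⟩ := hsub D hD
    have h2 := Set.image_mono (f := Subtype.val) (hiD.trans hDj)
    rw [himg, himg] at h2
    exact hDj.trans (Set.preimage_mono (hmax ⟨j, rfl⟩ h2))

/-- The largest member of a chain of irreducible closed sets lies in one `Z i`, and the whole chain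
with it. -/
theorem topologicalKrullDim_iUnion_le {X ι : Type*} [TopologicalSpace X] [Finite ι]
    {Z : ι → Set X} (hZ : ∀ i, IsClosed (Z i)) {d : WithBot ℕ∞}
    (hd : ∀ i, topologicalKrullDim (Z i) ≤ d) : topologicalKrullDim (⋃ i, Z i : Set X) ≤ d := by
  refine iSup_le fun p => ?_
  obtain ⟨i, hi⟩ := exists_subset_of_isIrreducible hZ
    ((p.toFun (Fin.last _)).isIrreducible.image Subtype.val continuous_subtype_val.continuousOn)
    (by rintro _ ⟨x, -, rfl⟩; exact x.2)
  refine le_trans ?_ (hd i)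
  let ι' : Z i → (⋃ i, Z i : Set X) := Set.inclusion (Set.subset_iUnion Z i)
  have hι : IsInducing ι' := (IsEmbedding.inclusion _).isInducing
  have himg : ∀ k, ι' '' (ι' ⁻¹' (p.toFun k : Set (⋃ i, Z i : Set X))) = p.toFun k := fun k => by
    rw [Set.image_preimage_eq_iff]
    intro x hx
    have hle : p.toFun k ≤ p.toFun (Fin.last _) := p.monotone (Fin.le_last k)
    exact ⟨⟨x.1, hi ⟨x, hle hx, rfl⟩⟩, rfl⟩
  let q : LTSeries (IrreducibleCloseds (Z i)) := LTSeries.mk p.length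
    (fun k => ⟨ι' ⁻¹' (p.toFun k : Set (⋃ i, Z i : Set X)),
      isIrreducible_of_image hι (by rw [himg]; exact (p.toFun k).isIrreducible),
      (p.toFun k).isClosed.preimage hι.continuous⟩)
    (fun k l hkl => by
      have hlt : p.toFun k < p.toFun l := p.strictMono hkl
      refine lt_of_le_not_ge (fun x hx => hlt.le hx) fun hge => hlt.not_ge ?_
      have := Set.image_mono (f := ι') (show ι' ⁻¹' (p.toFun l : Set (⋃ i, Z i : Set X)) ⊆
        ι' ⁻¹' (p.toFun k : Set (⋃ i, Z i : Set X)) from hge)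
      rwa [himg, himg] at this)
  exact le_iSup (fun q : LTSeries (IrreducibleCloseds (Z i)) => (q.length : WithBot ℕ∞)) q

/-! ### Connected components of Noetherian groups -/

section Group

variable {Γ : Type*} [Group Γ] [TopologicalSpace Γ]

/-- If irreducible components `C` and `D` contain `1`, then `C D` is irreducible and contains both,
so they coincide. By translation components are pairwise disjoint; being finitely many, they are
clopen. Only separate continuity of multiplication is assumed, as joint continuity fails for Zariski
topologies in general; irreducibility of `C D` is therefore checked one factor at a time. -/
theorem isIrreducible_connectedComponent_one [NoetherianSpace Γ]
    (hl : ∀ g : Γ, Continuous fun h => g * h) (hr : ∀ g : Γ, Continuous fun h => h * g) :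
    IsIrreducible (connectedComponent (1 : Γ)) := by
  have huniq : ∀ C D : Set Γ, C ∈ irreducibleComponents Γ → D ∈ irreducibleComponents Γ →
      (1 : Γ) ∈ C → (1 : Γ) ∈ D → C ⊆ D := by
    intro C D hC hD h1C h1D
    have hCD : IsIrreducible (Set.image2 (· * ·) C D) := by
      refine ⟨⟨1, 1, h1C, 1, h1D, one_mul 1⟩, isPreirreducible_iff_isClosed_union_isClosed.2
        fun A B hA hB hAB => ?_⟩
      have hcl : ∀ E : Set Γ, IsClosed E → IsClosed {c | ∀ d ∈ D, c * d ∈ E} := fun E hE => by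
        simp only [Set.ofPred_forall]
        exact isClosed_iInter fun d => isClosed_iInter fun _ => hE.preimage (hr d)
      have := isPreirreducible_iff_isClosed_union_isClosed.1 hC.1.isPreirreducible _ _
        (hcl A hA) (hcl B hB) (fun c hc => by
          have := isPreirreducible_iff_isClosed_union_isClosed.1 hD.1.isPreirreducible _ _
            (hA.preimage (hl c)) (hB.preimage (hl c))
            (fun d hd => hAB ⟨c, hc, d, hd, rfl⟩)
          exact this)
      simpa only [Set.image2_subset_iff] using! this
    intro c hc
    exact hD.2 hCD (fun d hd => ⟨1, h1C, d, hd, one_mul d⟩) ⟨c, hc, 1, h1D, mul_one c⟩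
  have htrans : ∀ (g : Γ) (C : Set Γ), C ∈ irreducibleComponents Γ →
      (fun h => g * h) '' C ∈ irreducibleComponents Γ := by
    intro g C hC
    refine ⟨hC.1.image _ (hl g).continuousOn, fun D hD hCD => ?_⟩
    have := hC.2 (hD.image _ (hl g⁻¹).continuousOn) (fun c hc =>
      ⟨g * c, hCD ⟨c, hc, rfl⟩, by simp⟩)
    intro d hd
    exact ⟨g⁻¹ * d, this ⟨d, hd, rfl⟩, by simp⟩
  set C := irreducibleComponent (1 : Γ) with hCdef
  have hC : C ∈ irreducibleComponents Γ := irreducibleComponent_mem_irreducibleComponents 1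
  have h1C : (1 : Γ) ∈ C := mem_irreducibleComponent
  have hdisj : ∀ D ∈ irreducibleComponents Γ, (D ∩ C).Nonempty → D ⊆ C := by
    rintro D hD ⟨g, hgD, hgC⟩ d hd
    have := huniq _ _ (htrans g⁻¹ D hD) (htrans g⁻¹ C hC) ⟨g, hgD, by simp⟩ ⟨g, hgC, by simp⟩
      ⟨d, hd, rfl⟩
    simpa using this
  have hclopen : IsClopen C := by
    refine ⟨isClosed_irreducibleComponent, ?_⟩
    have h : Cᶜ = ⋃₀ {D | D ∈ irreducibleComponents Γ ∧ D ≠ C} := by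
      ext g
      constructor
      · intro hg
        refine ⟨irreducibleComponent g, ⟨irreducibleComponent_mem_irreducibleComponents g, ?_⟩,
          mem_irreducibleComponent⟩
        rintro h
        exact hg (h ▸ mem_irreducibleComponent)
      · rintro ⟨D, ⟨hD, hDC⟩, hgD⟩ hgC
        have hle := hdisj D hD ⟨g, hgD, hgC⟩
        exact hDC (hle.antisymm (hD.2 hC.1 hle))
    rw [← isClosed_compl_iff, h]
    rw [Set.sUnion_eq_biUnion]
    exact Set.Finite.isClosed_biUnion ((NoetherianSpace.finite_irreducibleComponents).subset
      fun D hD => hD.1) fun D hD => isClosed_of_mem_irreducibleComponents D hD.1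
  have : connectedComponent (1 : Γ) = C :=
    (hclopen.connectedComponent_subset h1C).antisymm
      (hC.1.isConnected.isPreconnected.subset_connectedComponent h1C)
  rw [this]
  exact hC.1

theorem isIrreducible_connectedComponentIn_one [NoetherianSpace Γ]
    (hl : ∀ g : Γ, Continuous fun h => g * h) (hr : ∀ g : Γ, Continuous fun h => h * g)
    (H : Subgroup Γ) : IsIrreducible (connectedComponentIn (H : Set Γ) 1) := by
  have : NoetherianSpace H := IsInducing.subtypeVal.noetherianSpace
  have h := isIrreducible_connectedComponent_one (Γ := H)
    (fun g => ((hl g).comp continuous_subtype_val).subtype_mk _)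
    (fun g => ((hr g).comp continuous_subtype_val).subtype_mk _)
  rw [connectedComponentIn_eq_image H.one_mem]
  exact h.image _ continuous_subtype_val.continuousOn

theorem isClosed_connectedComponentIn {X : Type*} [TopologicalSpace X] {F : Set X}
    (hF : IsClosed F) (x : X) : IsClosed (connectedComponentIn F x) := by
  by_cases hx : x ∈ F
  · rw [connectedComponentIn_eq_image hx]
    exact hF.isClosedEmbedding_subtypeVal.isClosedMap _ isClosed_connectedComponent
  · rw [connectedComponentIn_eq_empty hx]
    exact isClosed_empty

end Group

end FunAlg

/-! ### Automorphisms of multialgebras -/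

namespace Multialg

open FunAlg Module
open scoped Topology

variable {K : Type*} [Field K] {A : Type*} [AddCommGroup A] [Module K A]
  {I : Type*} {n : I → ℕ} {μ : ∀ i, MultilinearMap K (fun _ : Fin (n i) => A) A}

theorem isPolyMap_apply (a : A) : IsPolyMap (glAlg K A) (fun g : A ≃ₗ[K] A => g a) :=
  isPolyMap_coe.linear (LinearMap.applyₗ a)

theorem isSubalgebra_generated (S : Set A) : IsSubalgebra μ (generated μ S) := by
  intro i x hx
  refine Submodule.mem_sInf.2 fun C hC => hC.1 i x fun j => ?_
  exact Submodule.mem_sInf.1 (hx j) C hC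

theorem subset_generated (S : Set A) : S ⊆ generated μ S := fun _ ha =>
  Submodule.mem_sInf.2 fun _ hC => hC.2 ha

theorem generated_le {S : Set A} {C : Submodule K A} (hC : IsSubalgebra μ C) (hS : S ⊆ C) :
    generated μ S ≤ C := sInf_le ⟨hC, hS⟩

variable [FiniteDimensional K A]

variable (μ) in
theorem isClosed_autGroup : IsClosed[zariskiGL K A] (autGroup μ : Set (A ≃ₗ[K] A)) := by
  rw [zariskiGL_eq_funTop]
  let := funTop (glAlg K A)
  have : (autGroup μ : Set (A ≃ₗ[K] A)) =
      ⋂ (i) (x : Fin (n i) → A), {g | g (μ i x) = μ i fun j => g (x j)} := by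
    ext g
    simp only [Set.mem_iInter]
    rfl
  rw [this]
  exact isClosed_iInter fun i => isClosed_iInter fun x =>
    (isPolyMap_apply _).isClosed_eq (IsPolyMap.multilinear (fun j => isPolyMap_apply (x j)) (μ i))

variable (μ) in
theorem isClosed_autZero : IsClosed[zariskiGL K A] (autZero μ : Set (A ≃ₗ[K] A)) :=
  let := zariskiGL K A
  isClosed_connectedComponentIn (isClosed_autGroup μ) 1

variable (μ) in
theorem isIrreducible_autZero :
    @IsIrreducible _ (zariskiGL K A) (autZero μ : Set (A ≃ₗ[K] A)) := by
  let := zariskiGL K A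
  have h : TopologicalSpace.NoetherianSpace (A ≃ₗ[K] A) := by
    have := (isAffine_glAlg (K := K) (V := A)).noetherianSpace
    rwa [← zariskiGL_eq_funTop] at this
  refine isIrreducible_connectedComponentIn_one (fun g => ?_) (fun g => ?_) _
  · have := continuous_of_pull_le (pull_mul_left_le g)
    rwa [← zariskiGL_eq_funTop] at this
  · have := continuous_of_pull_le (pull_mul_right_le g)
    rwa [← zariskiGL_eq_funTop] at this

variable (μ) in
-- Since `g` preserves dimension, `g(B) ⊆ B` forces equality; the inclusion is visibly a closed
-- condition on `g`.
theorem mem_stab_iff (B : Submodule K A) (g : A ≃ₗ[K] A) :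
    g ∈ stab μ B ↔ g ∈ autZero μ ∧ ∀ b ∈ B, g b ∈ B := by
  change g ∈ autZero μ ∧ B.map (g : A →ₗ[K] A) = B ↔ _
  refine and_congr_right fun _ => ⟨fun h b hb => ?_, fun h => ?_⟩
  · have := Submodule.mem_map_of_mem (f := (g : A →ₗ[K] A)) hb
    rwa [h] at this
  · refine Submodule.eq_of_le_of_finrank_eq (Submodule.map_le_iff_le_comap.2 h) ?_
    exact LinearEquiv.finrank_map_eq g B

variable (μ) in
theorem isClosed_stab (B : Submodule K A) :
    IsClosed[zariskiGL K A] (stab μ B : Set (A ≃ₗ[K] A)) := by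
  have h := isClosed_autZero μ
  rw [zariskiGL_eq_funTop] at h ⊢
  let := funTop (glAlg K A)
  have : (stab μ B : Set (A ≃ₗ[K] A)) =
      (autZero μ : Set (A ≃ₗ[K] A)) ∩ ⋂ b ∈ B, {g | B.mkQ (g b) = 0} := by
    ext g
    rw [SetLike.mem_coe, mem_stab_iff]
    simp
  rw [this]
  exact h.inter (isClosed_iInter fun b => isClosed_iInter fun _ =>
    ((isPolyMap_apply b).linear B.mkQ).isClosed_eq (IsPolyMap.const 0))

/-! ### Generation by polynomial maps -/

/-- The values at `a` of such maps `w` form a subalgebra containing the entries of `a`. -/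
theorem exists_isPolyMap_eq_of_mem_generated {r : ℕ} {a : Fin r → A} {b : A}
    (hb : b ∈ generated μ (Set.range a)) :
    ∃ w : (Fin r → A) → A, IsPolyMap (polyFun K (Fin r → A)) w ∧
      (∀ a, w a ∈ generated μ (Set.range a)) ∧ w a = b := by
  let C : Submodule K A :=
    { carrier := {b | ∃ w : (Fin r → A) → A, IsPolyMap (polyFun K (Fin r → A)) w ∧
        (∀ a, w a ∈ generated μ (Set.range a)) ∧ w a = b}
      add_mem' := by
        rintro _ _ ⟨w, hw, hwa, rfl⟩ ⟨w', hw', hwa', rfl⟩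
        exact ⟨_, hw.add hw', fun a => add_mem (hwa a) (hwa' a), rfl⟩
      zero_mem' := ⟨_, IsPolyMap.const 0, fun a => zero_mem _, rfl⟩
      smul_mem' := by
        rintro c _ ⟨w, hw, hwa, rfl⟩
        exact ⟨_, hw.linear (LinearMap.lsmul K A c), fun a => Submodule.smul_mem _ c (hwa a),
          rfl⟩ }
  have hC : IsSubalgebra μ C := by
    intro i x hx
    choose w hw hwa hwx using hx
    refine ⟨_, IsPolyMap.multilinear hw (μ i),
      fun a => isSubalgebra_generated _ i _ fun j => hwa j a, ?_⟩
    simp only [hwx]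
  refine generated_le hC ?_ hb
  rintro _ ⟨j, rfl⟩
  exact ⟨fun a => a j, (IsPolyMap.id (K := K) (V := Fin r → A)).linear (LinearMap.proj j),
    fun a => subset_generated _ ⟨j, rfl⟩, rfl⟩

/-- Express a basis of `B` by polynomial words in `a`. The function `p` is the determinant of the
coordinates of these words; where it is nonzero, the words remain linearly independent, and for
tuples in `B` they generate all of `B` by dimension. -/
theorem exists_polyFun_generated_eq {r : ℕ} {a : Fin r → A} {B : Submodule K A}
    (ha : generated μ (Set.range a) = B) :
    ∃ p ∈ polyFun K (Fin r → A), p a ≠ 0 ∧ ∀ a' : Fin r → A, (∀ j, a' j ∈ B) → p a' ≠ 0 →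
      generated μ (Set.range a') = B := by
  obtain ⟨π, hπ⟩ := B.subtype.exists_leftInverse_of_injective B.ker_subtype
  let b := Module.finBasis K B
  have hb : ∀ k, ∃ w : (Fin r → A) → A, IsPolyMap (polyFun K (Fin r → A)) w ∧
      (∀ a, w a ∈ generated μ (Set.range a)) ∧ w a = b k := fun k =>
    exists_isPolyMap_eq_of_mem_generated (ha ▸ (b k).2)
  choose w hw hwa hwb using hb
  refine ⟨_, IsPolyMap.det_mem (M := fun x => Matrix.of fun k i => b.coord i (π (w k x)))
    fun k i => hw k ((b.coord i).comp π), ?_, fun a' ha' h => ?_⟩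
  · have : (Matrix.of fun k i => b.coord i (π (w k a)) : Matrix _ _ K) = 1 := by
      ext k i
      have h1 : π (b k : A) = b k := LinearMap.congr_fun hπ (b k)
      simp [hwb, h1, Matrix.one_apply, Finsupp.single_apply]
    change Matrix.det _ ≠ 0
    rw [this, Matrix.det_one]
    exact one_ne_zero
  · have hB : IsSubalgebra μ B := ha ▸ isSubalgebra_generated _
    have hle : generated μ (Set.range a') ≤ B := generated_le hB (by
      rintro _ ⟨j, rfl⟩
      exact ha' j)
    refine Submodule.eq_of_le_of_finrank_le hle ?_
    have h1 := Matrix.linearIndependent_rows_of_det_ne_zero h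
    have h2 : LinearIndependent K fun k => w k a' :=
      LinearIndependent.of_comp (LinearMap.pi fun i => (b.coord i).comp π) h1
    have h3 := finrank_span_eq_card h2
    rw [Fintype.card_fin] at h3
    rw [← h3]
    refine Submodule.finrank_mono (Submodule.span_le.2 ?_)
    rintro _ ⟨k, rfl⟩
    exact hwa k a'

theorem isClosed_nonGenerating (r : ℕ) :
    IsClosed[zariski K (Fin r → A)] (nonGenerating μ r) := by
  rw [zariski_eq_funTop]
  let := funTop (polyFun K (Fin r → A))
  rw [← isOpen_compl_iff, isOpen_iff_forall_mem_open]
  intro a ha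
  obtain ⟨p, hp, hpa, h⟩ := exists_polyFun_generated_eq (not_not.1 ha)
  refine ⟨{a | p a = 0}ᶜ, fun a' ha' => ?_, (isClosed_zero hp).isOpen_compl, hpa⟩
  exact not_not.2 (h a' (fun _ => Submodule.mem_top) ha')

end Multialg

/-! ### Dimension of the sweep of a subspace -/

namespace FunAlg

open Multialg Module
open scoped Topology

variable {K : Type*} [Field K] {X Y : Type*}

theorem IsPolyMap.comp_fst {V : Type*} [AddCommGroup V] [Module K V] {R : Subalgebra K (X → K)}
    {f : X → V} (hf : IsPolyMap R f) (σ : Type*) :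
    IsPolyMap (prodAlg R σ) (fun z => f z.1) := fun l => comp_fst_mem_prodAlg (hf l)

/-- A function vanishing on the range vanishes on its closure, so both have the same algebra of
functions. -/
theorem topologicalKrullDim_closure_range [IsAlgClosed K] {R : Subalgebra K (X → K)}
    (hR : IsAffine R) (f : Y → X) :
    letI := funTop R
    topologicalKrullDim (closure (Set.range f)) = ringKrullDim (pull f R) := by
  let := funTop R
  let C := closure (Set.range f)
  have hC := hR.pull_subtype (Z := C) isClosed_closure
  have hdim := hC.topologicalKrullDim_eq
  rw [funTop_pull] at hdim
  refine hdim.trans ?_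
  let f' : Y → C := fun y => ⟨f y, subset_closure ⟨y, rfl⟩⟩
  have hf' : pull f R = pull f' (pull (Subtype.val : C → X) R) := by
    rw [pull_pull]
    rfl
  rw [hf']
  refine ringKrullDim_eq_of_ringEquiv (RingEquiv.ofBijective (toPull f' _).toRingHom
    ⟨(injective_iff_map_eq_zero _).2 ?_, toPull_surjective _ _⟩)
  rintro ⟨_, p, hp, rfl⟩ h0
  have hle : C ⊆ {x | p x = 0} := closure_minimal (by
    rintro _ ⟨y, rfl⟩
    exact congrFun (congrArg Subtype.val h0) y) (isClosed_zero hp)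
  ext x
  exact hle x.2

theorem isInducing_of_pull_eq {P : Subalgebra K (Y → K)} {R : Subalgebra K (X → K)} {f : Y → X}
    (h : pull f R = P) : @Topology.IsInducing _ _ (funTop P) (funTop R) f := by
  let := funTop R
  let := funTop P
  refine ⟨?_⟩
  rw [← funTop_pull, h]

end FunAlg

namespace Multialg

open FunAlg Module
open scoped Topology

variable {K : Type*} [Field K] {A : Type*} [AddCommGroup A] [Module K A]
  {I : Type*} {n : I → ℕ} (μ : ∀ i, MultilinearMap K (fun _ : Fin (n i) => A) A)

/-- The algebra of regular functions on a subset of `GL(A)`. -/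
def regular (S : Set (A ≃ₗ[K] A)) : Subalgebra K (S → K) :=
  pull Subtype.val (glAlg K A)

/-- The element of `B ^ r` with the given coordinates. -/
noncomputable def ofCoord (r : ℕ) {B : Submodule K A} {ι : Type*} [Fintype ι] (b : Basis ι K B)
    (c : Fin r × ι → K) : Fin r → A := fun j => ∑ k, c (j, k) • (b k : A)

/-- The map `(g, w) ↦ g w` on the product of the identity component of the automorphism group
and `B ^ r`. -/
noncomputable def sweepMap (r : ℕ) {B : Submodule K A} {ι : Type*} [Fintype ι] (b : Basis ι K B)
    (z : ↥(autZero μ : Set (A ≃ₗ[K] A)) × (Fin r × ι → K)) : Fin r → A :=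
  fun j => z.1.1 (ofCoord r b z.2 j)

variable {r : ℕ} {B : Submodule K A} {ι : Type*} [Fintype ι] (b : Basis ι K B)

theorem ofCoord_mem (c : Fin r × ι → K) (j : Fin r) : ofCoord r b c j ∈ B :=
  Submodule.sum_mem _ fun k _ => B.smul_mem _ (b k).2

theorem exists_coord (b : Basis ι K B) : ∃ l : ι → Dual K A,
    (∀ (c : Fin r × ι → K) j k, l k (ofCoord r b c j) = c (j, k)) ∧
    ∀ v : Fin r → A, (∀ j, v j ∈ B) → ofCoord r b (fun i => l i.2 (v i.1)) = v := by
  obtain ⟨π, hπ⟩ := B.subtype.exists_leftInverse_of_injective B.ker_subtype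
  have h1 : ∀ v : B, π v = v := fun v => LinearMap.congr_fun hπ v
  classical
  refine ⟨fun k => (b.coord k).comp π, fun c j k => ?_, fun v hv => ?_⟩
  · simp [ofCoord, h1, Finsupp.single_apply]
  · ext j
    have h2 : π (v j) = ⟨v j, hv j⟩ := h1 ⟨v j, hv j⟩
    have := congrArg B.subtype (b.sum_repr ⟨v j, hv j⟩)
    rw [map_sum] at this
    simp only [ofCoord, LinearMap.comp_apply, h2, Basis.coord_apply]
    exact this

theorem autZero_le_autGroup : autZero μ ≤ autGroup μ :=
  @connectedComponentIn_subset _ (zariskiGL K A) _ _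

theorem range_sweepMap : Set.range (sweepMap μ r b) =
    ⋃ g ∈ autZero μ, {a | ∀ j, a j ∈ B.map (g : A →ₗ[K] A)} := by
  ext a
  simp only [Set.mem_range, Set.mem_iUnion, Set.mem_ofPred_eq]
  constructor
  · rintro ⟨⟨g, c⟩, rfl⟩
    exact ⟨g.1, g.2, fun j => Submodule.mem_map_of_mem (ofCoord_mem b c j)⟩
  · rintro ⟨g, hg, h⟩
    choose v hv hva using h
    obtain ⟨l, -, hl⟩ := exists_coord (r := r) b
    refine ⟨(⟨g, hg⟩, fun i => l i.2 (v i.1)), ?_⟩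
    ext j
    simp only [sweepMap, hl v hv]
    exact hva j

theorem sweep_eq_closure_range :
    sweep μ r B = @closure _ (zariski K (Fin r → A)) (Set.range (sweepMap μ r b)) := by
  rw [range_sweepMap]
  rfl

theorem isPolyMap_ofCoord (R : Subalgebra K (↥(autZero μ : Set (A ≃ₗ[K] A)) → K)) :
    IsPolyMap (prodAlg R (Fin r × ι)) (fun z => ofCoord r b z.2) :=
  IsPolyMap.pi fun _ => IsPolyMap.sum fun _ _ =>
    (IsPolyMap.const _).smul (coord_mem_prodAlg _ _)

theorem isClosed_sweep (r : ℕ) (B : Submodule K A) :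
    IsClosed[zariski K (Fin r → A)] (sweep μ r B) :=
  let := zariski K (Fin r → A)
  isClosed_closure

variable [FiniteDimensional K A]

theorem isPolyMap_sweepMap :
    IsPolyMap (prodAlg (regular (autZero μ : Set (A ≃ₗ[K] A))) (Fin r × ι))
      (sweepMap μ r b) :=
  IsPolyMap.pi fun j => IsPolyMap.bilinear ((isPolyMap_coe.comp Subtype.val).comp_fst _)
    ((isPolyMap_ofCoord μ b _).linear (LinearMap.proj j)) LinearMap.id

theorem isAffine_regular {S : Set (A ≃ₗ[K] A)} (hS : IsClosed[zariskiGL K A] S) :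
    IsAffine (regular S) := by
  rw [zariskiGL_eq_funTop] at hS
  exact isAffine_glAlg.pull_subtype hS

theorem hasDim_regular [IsAlgClosed K] {S : Set (A ≃ₗ[K] A)} (hS : IsClosed[zariskiGL K A] S)
    {d : ℕ} (hd : ringKrullDim (regular S) = d) : HasDim (zariskiGL K A) S d := by
  have h := (isAffine_regular hS).topologicalKrullDim_eq
  rw [regular, funTop_pull, ← zariskiGL_eq_funTop, ← regular, hd] at h
  exact h

theorem isDomain_regular_autZero : IsDomain (regular (autZero μ : Set (A ≃ₗ[K] A))) := by
  refine isDomain_of_irreducibleSpace _ ?_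
  rw [regular, funTop_pull, ← zariskiGL_eq_funTop]
  let := zariskiGL K A
  exact Subtype.irreducibleSpace (isIrreducible_autZero μ)

/-! ### Fibres of the sweep map and the stabilizer. -/

section Fiber

variable {μ}
variable (z : ↥(autZero μ : Set (A ≃ₗ[K] A)) × (Fin r × ι → K))

/-- For `z = (g, w)` the map is `J s = (g s⁻¹, s w)`. Since `s` is recovered from `(g', w')` as
`g'⁻¹ g`, every regular function on the stabilizer is a pullback along `J`, so `J` is a topological
embedding. -/
theorem exists_stab_embedding :
    ∃ J : ↥(stab μ B : Set (A ≃ₗ[K] A)) → ↥(autZero μ : Set (A ≃ₗ[K] A)) × (Fin r × ι → K),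
      pull J (prodAlg (regular (autZero μ : Set (A ≃ₗ[K] A))) (Fin r × ι)) =
        regular (stab μ B : Set (A ≃ₗ[K] A)) ∧
      Function.Injective J ∧
      (∀ s, sweepMap μ r b (J s) = sweepMap μ r b z) ∧
      ((generated μ (Set.range (ofCoord r b z.2)) = B) →
        ∀ z', sweepMap μ r b z' = sweepMap μ r b z → z' ∈ Set.range J) := by
  obtain ⟨l, hl1, hl2⟩ := exists_coord (r := r) b
  have hst : ∀ s ∈ stab μ B, s ∈ autZero μ ∧ ∀ x ∈ B, s x ∈ B := fun s hs =>
    (mem_stab_iff μ B s).1 hs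
  let J : ↥(stab μ B : Set (A ≃ₗ[K] A)) → ↥(autZero μ : Set (A ≃ₗ[K] A)) × (Fin r × ι → K) :=
    fun s => (⟨z.1.1 * s.1⁻¹, (autZero μ).mul_mem z.1.2 ((autZero μ).inv_mem (hst _ s.2).1)⟩,
      fun i => l i.2 (s.1 (ofCoord r b z.2 i.1)))
  let e : ↥(autZero μ : Set (A ≃ₗ[K] A)) → (A ≃ₗ[K] A) := fun g => g.1⁻¹ * z.1.1
  have heJ : ∀ s, e (J s).1 = s.1 := fun s => by simp [e, J]
  refine ⟨J, le_antisymm ?_ ?_, ?_, ?_, ?_⟩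
  · refine pull_prodAlg_le ?_ fun i => ?_
    · rw [regular, pull_pull]
      have : (Subtype.val ∘ fun s => (J s).1) =
          ((fun h => z.1.1 * h) ∘ (fun h => h⁻¹)) ∘
            (Subtype.val : ↥(stab μ B : Set (A ≃ₗ[K] A)) → _) := rfl
      rw [this, ← pull_pull, ← pull_pull]
      exact Subalgebra.map_mono ((Subalgebra.map_mono (pull_mul_left_le _)).trans pull_inv_le)
    · exact (isPolyMap_apply (ofCoord r b z.2 i.1)).comp Subtype.val (l i.2)
  · have h1 : regular (stab μ B : Set (A ≃ₗ[K] A)) = pull J (pull Prod.fst (pull e (glAlg K A))) := by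
      rw [regular, pull_pull, pull_pull]
      congr 1
      ext1 s
      exact (heJ s).symm
    have h2 : pull e (glAlg K A) ≤ regular (autZero μ : Set (A ≃ₗ[K] A)) := by
      have : e = ((fun h => h * z.1.1) ∘ (fun h => h⁻¹)) ∘
            (Subtype.val : ↥(autZero μ : Set (A ≃ₗ[K] A)) → _) := rfl
      rw [this, ← pull_pull, ← pull_pull]
      exact Subalgebra.map_mono ((Subalgebra.map_mono (pull_mul_right_le _)).trans pull_inv_le)
    rw [h1]
    refine Subalgebra.map_mono ?_
    rintro _ ⟨p, hp, rfl⟩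
    exact comp_fst_mem_prodAlg (h2 hp)
  · intro s s' h
    exact Subtype.ext (by rw [← heJ s, ← heJ s', h])
  · intro s
    ext j
    have h3 := hl2 (fun j => s.1 (ofCoord r b z.2 j)) fun j => (hst _ s.2).2 _ (ofCoord_mem b _ j)
    simp only [sweepMap, J, h3]
    simp
  · intro hgen z' hz'
    have hz : ∀ j, (z'.1.1⁻¹ * z.1.1) (ofCoord r b z.2 j) = ofCoord r b z'.2 j := fun j => by
      have := congrFun hz' j
      simp only [sweepMap] at this
      rw [LinearEquiv.mul_apply, ← this]
      exact z'.1.1.symm_apply_apply _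
    have hs : z'.1.1⁻¹ * z.1.1 ∈ stab μ B := by
      have hmem : z'.1.1⁻¹ * z.1.1 ∈ autZero μ :=
        (autZero μ).mul_mem ((autZero μ).inv_mem z'.1.2) z.1.2
      refine (mem_stab_iff μ B _).2 ⟨hmem, ?_⟩
      have haut : z'.1.1⁻¹ * z.1.1 ∈ autGroup μ := autZero_le_autGroup μ hmem
      have hB : IsSubalgebra μ B := hgen ▸ isSubalgebra_generated _
      -- The preimage of `B` under an automorphism is a subalgebra; it contains the generators `w`,
      -- hence `B`.
      have hle : generated μ (Set.range (ofCoord r b z.2)) ≤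
          B.comap ((z'.1.1⁻¹ * z.1.1 : A ≃ₗ[K] A) : A →ₗ[K] A) := by
        refine generated_le (fun i x hx => ?_) ?_
        · change (z'.1.1⁻¹ * z.1.1) (μ i x) ∈ B
          rw [haut i x]
          exact hB i _ hx
        · rintro _ ⟨j, rfl⟩
          change (z'.1.1⁻¹ * z.1.1) (ofCoord r b z.2 j) ∈ B
          rw [hz j]
          exact ofCoord_mem b _ j
      rw [hgen] at hle
      exact hle
    refine ⟨⟨_, hs⟩, Prod.ext (Subtype.ext ?_) ?_⟩
    · simp [J]
    · ext i
      simp only [J, hz, hl1]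

end Fiber

/-! ### Dimensions of the identity component, the sweeps and the stabilizers. -/

theorem exists_hasDim_autZero [IsAlgClosed K] :
    ∃ d : ℕ, ringKrullDim (regular (autZero μ : Set (A ≃ₗ[K] A))) = d ∧
      HasDim (zariskiGL K A) (autZero μ) d := by
  have hG := isAffine_regular (isClosed_autZero μ)
  have := hG.finiteType
  have := isDomain_regular_autZero μ
  obtain ⟨d, -, -, hd⟩ := exists_noether_normalization K (regular (autZero μ : Set (A ≃ₗ[K] A)))
  exact ⟨d, hd, hasDim_regular (isClosed_autZero μ) hd⟩

theorem isIrreducible_sweep [IsAlgClosed K] (r : ℕ) (B : Submodule K A) :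
    @IsIrreducible _ (zariski K (Fin r → A)) (sweep μ r B) := by
  let b := Module.finBasis K B
  rw [sweep_eq_closure_range μ b]
  have := isDomain_regular_autZero μ
  have := isDomain_prodAlg (regular (autZero μ : Set (A ≃ₗ[K] A))) (Fin r × Fin (finrank K B))
  have h := irreducibleSpace_of_isDomain
    (prodAlg (regular (autZero μ : Set (A ≃ₗ[K] A))) (Fin r × Fin (finrank K B)))
  have hc := continuous_zariski_of_isPolyMap (isPolyMap_sweepMap (r := r) μ b)
  let := zariski K (Fin r → A)
  let := funTop (prodAlg (regular (autZero μ : Set (A ≃ₗ[K] A))) (Fin r × Fin (finrank K B)))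
  rw [← Set.image_univ]
  exact ((IrreducibleSpace.isIrreducible_univ _).image _ hc.continuousOn).closure

/-- The fibre theorem gives `dY + d = dG + r dim B`; the embedding of the stabilizer in a general
fibre gives `dS ≤ d`, with equality as soon as one general fibre passes through a generating tuple.
-/
theorem exists_hasDim_sweep [IsAlgClosed K] (r : ℕ) (B : Submodule K A) {dG : ℕ}
    (hdG : ringKrullDim (regular (autZero μ : Set (A ≃ₗ[K] A))) = dG) :
    ∃ dY dS : ℕ, HasDim (zariski K (Fin r → A)) (sweep μ r B) dY ∧
      HasDim (zariskiGL K A) (stab μ B) dS ∧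
      dY + dS ≤ dG + r * finrank K B ∧
      ((∃ a : Fin r → A, generated μ (Set.range a) = B) →
        dY + dS = dG + r * finrank K B) := by
  let b := Module.finBasis K B
  have hG := isAffine_regular (isClosed_autZero μ)
  have := isDomain_regular_autZero μ
  set R := prodAlg (regular (autZero μ : Set (A ≃ₗ[K] A))) (Fin r × Fin (finrank K B)) with hRdef
  have hR : IsAffine R := isAffine_prodAlg hG _
  have hRdom : IsDomain R := isDomain_prodAlg _ _
  have hRdim : ringKrullDim R = (dG + r * finrank K B : ℕ) := by
    rw [ringKrullDim_prodAlg hG, hdG]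
    simp
  have hpoly : IsPolyMap R (sweepMap μ r b) := isPolyMap_sweepMap μ b
  obtain ⟨dY, d, h, hh, h0, hdY, hYd, hfib⟩ := exists_dim_fiber hR hpoly.pull_le
    (isAffine_polyFun.fg.map (pullHom K (sweepMap μ r b)))
  have hsum : dY + d = dG + r * finrank K B := by
    rw [hRdim] at hYd
    exact_mod_cast hYd.symm
  have hY : HasDim (zariski K (Fin r → A)) (sweep μ r B) dY := by
    rw [sweep_eq_closure_range μ b, zariski_eq_funTop]
    exact (topologicalKrullDim_closure_range isAffine_polyFun _).trans hdY
  have hfib' : ∀ z : ↥(autZero μ : Set (A ≃ₗ[K] A)) × (Fin r × Fin (finrank K B) → K),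
      {z' | ∀ p ∈ pull (sweepMap μ r b) (polyFun K (Fin r → A)), p z' = p z} =
        {z' | sweepMap μ r b z' = sweepMap μ r b z} := fun z => by
    ext z'
    simp only [Set.mem_ofPred_eq]
    constructor
    · intro h
      rw [← sub_eq_zero, ← Module.forall_dual_apply_eq_zero_iff K]
      intro l
      rw [map_sub, sub_eq_zero]
      exact h _ (IsPolyMap.id.comp (sweepMap μ r b) l)
    · rintro h _ ⟨p, -, rfl⟩
      exact congrArg p h
  have hS := isAffine_regular (isClosed_stab μ B)
  have hSdim := hS.topologicalKrullDim_eq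
  have hle : ∀ z, h z ≠ 0 → ringKrullDim (regular (stab μ B : Set (A ≃ₗ[K] A))) ≤ d ∧
      ((generated μ (Set.range (ofCoord r b z.2)) = B) →
        ringKrullDim (regular (stab μ B : Set (A ≃ₗ[K] A))) = d) := by
    intro z hz
    obtain ⟨J, hJR, hJinj, hJ, hJsurj⟩ := exists_stab_embedding b z
    have hdim := hfib z hz
    rw [hfib'] at hdim
    let := funTop R
    let := funTop (regular (stab μ B : Set (A ≃ₗ[K] A)))
    have hind : Topology.IsInducing J := isInducing_of_pull_eq hJR
    let J' : ↥(stab μ B : Set (A ≃ₗ[K] A)) → {z' | sweepMap μ r b z' = sweepMap μ r b z} :=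
      fun s => ⟨J s, hJ s⟩
    have hind' : Topology.IsInducing J' := hind.codRestrict hJ
    have hdim' : topologicalKrullDim {z' | sweepMap μ r b z' = sweepMap μ r b z} = d := hdim
    rw [← hSdim, ← hdim']
    refine ⟨hind'.topologicalKrullDim_le, fun hgen => IsHomeomorph.topologicalKrullDim_eq J' ?_⟩
    refine isHomeomorph_iff_isEmbedding_surjective.2
      ⟨⟨hind', fun s s' h => hJinj (congrArg Subtype.val h)⟩, fun z' => ?_⟩
    obtain ⟨s, hs⟩ := hJsurj hgen z'.1 z'.2
    exact ⟨s, Subtype.ext hs⟩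
  obtain ⟨z, hz⟩ := Function.ne_iff.1 h0
  obtain ⟨dS, hdS⟩ : ∃ dS : ℕ, ringKrullDim (regular (stab μ B : Set (A ≃ₗ[K] A))) = dS := by
    have h1 := (hle z hz).1
    have : Nontrivial (regular (stab μ B : Set (A ≃ₗ[K] A))) :=
      ⟨0, 1, fun h => zero_ne_one
        (congrFun (congrArg Subtype.val h) (⟨1, (stab μ B).one_mem⟩ : ↥(stab μ B : Set (A ≃ₗ[K] A))))⟩
    have h2 := ringKrullDim_nonneg_of_nontrivial (R := regular (stab μ B : Set (A ≃ₗ[K] A)))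
    obtain ⟨e, he⟩ := WithBot.ne_bot_iff_exists.1 (ne_bot_of_le_ne_bot WithBot.zero_ne_bot h2)
    rw [← he] at h1 ⊢
    have h3 : e ≤ d := WithBot.coe_le_coe.1 h1
    obtain ⟨k, rfl⟩ := ENat.ne_top_iff_exists.1 (ne_top_of_le_ne_top (ENat.natCast_ne_top d) h3)
    exact ⟨k, rfl⟩
  refine ⟨dY, dS, hY, hasDim_regular (isClosed_stab μ B) hdS, ?_, ?_⟩
  · have := (hle z hz).1
    rw [hdS] at this
    have : dS ≤ d := by exact_mod_cast this
    omega
  · rintro ⟨a, ha⟩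
    obtain ⟨p, hp, hpa, hpgen⟩ := exists_polyFun_generated_eq ha
    obtain ⟨l, -, hl⟩ := exists_coord (r := r) b
    have hpR := (isPolyMap_ofCoord (r := r) μ b
      (regular (autZero μ : Set (A ≃ₗ[K] A)))).comp_mem hp
    have hhR : h ∈ R := hpoly.pull_le hh
    -- The source is irreducible, so the open sets `h ≠ 0` (general fibre) and `p ≠ 0` (the tuple
    -- generates `B`) have a common point.
    have hne : (⟨h, hhR⟩ * ⟨_, hpR⟩ : R) ≠ 0 := by
      refine mul_ne_zero (fun h' => h0 (congrArg Subtype.val h')) fun h' => hpa ?_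
      have := congrFun (congrArg Subtype.val h')
        (⟨1, (autZero μ).one_mem⟩, fun i => l i.2 (a i.1))
      have hav : ∀ j, a j ∈ B := fun j => ha ▸ subset_generated _ ⟨j, rfl⟩
      simpa [hl a hav] using! this
    obtain ⟨z, hz⟩ := Function.ne_iff.1 fun h' => hne (Subtype.ext h')
    have hz1 : h z ≠ 0 := left_ne_zero_of_mul hz
    have hz2 : p (ofCoord r b z.2) ≠ 0 := right_ne_zero_of_mul hz
    have := (hle z hz1).2 (hpgen _ (ofCoord_mem b _) hz2)
    rw [hdS] at this
    have : dS = d := by exact_mod_cast this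
    omega

/-- Passing to closures adds nothing, because the set of non-generating tuples is already closed. -/
theorem nonGenerating_eq_iUnion_sweep {t : ℕ} {B : Fin t → Submodule K A}
    (hmax : ∀ i, IsMaximalSubalgebra μ (B i))
    (hrep : ∀ C, IsMaximalSubalgebra μ C →
      ∃ i, ∃ g ∈ autZero μ, C = (B i).map (g : A →ₗ[K] A)) (r : ℕ) :
    nonGenerating μ r = ⋃ i, sweep μ r (B i) := by
  refine Set.Subset.antisymm (fun a ha => ?_) (Set.iUnion_subset fun i => ?_)
  · have hex : ∃ C, generated μ (Set.range a) ≤ C ∧ IsMaximalSubalgebra μ C :=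
      exists_maximal_ge_of_wellFoundedGT _ _ ⟨isSubalgebra_generated _, ha⟩
    obtain ⟨C, hC⟩ := hex
    obtain ⟨i, g, hg, hCg⟩ := hrep C hC.2
    refine Set.mem_iUnion.2 ⟨i, @subset_closure _ (zariski K (Fin r → A)) _ _
      (Set.mem_iUnion₂.2 ⟨g, hg, fun j => ?_⟩)⟩
    rw [← hCg]
    exact hC.1 (subset_generated _ ⟨j, rfl⟩)
  · refine @closure_minimal _ (zariski K (Fin r → A)) _ _ ?_ (isClosed_nonGenerating r)
    refine Set.iUnion₂_subset fun g hg a ha h => ?_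
    have haut : g ∈ autGroup μ := autZero_le_autGroup μ hg
    have hsub : IsSubalgebra μ ((B i).map (g : A →ₗ[K] A)) := by
      intro k x hx
      choose y hy hyx using hx
      refine ⟨μ k y, (hmax i).1.1 k y hy, ?_⟩
      have := haut k y
      refine this.trans ?_
      congr 1
      ext j
      exact hyx j
    have h1 := generated_le (S := Set.range a) hsub (by rintro _ ⟨j, rfl⟩; exact ha j)
    rw [h, top_le_iff] at h1
    apply (hmax i).1.2
    have h2 := LinearEquiv.finrank_map_eq g (B i)
    rw [h1, finrank_top] at h2
    exact Submodule.eq_top_of_finrank_eq h2.symm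

end Multialg

/-! ### The main theorem. -/

theorem theorem1p3 {K : Type*} [Field K] [IsAlgClosed K]
    {A : Type*} [AddCommGroup A] [Module K A] [FiniteDimensional K A]
    {I : Type*} {n : I → ℕ} (μ : ∀ i, MultilinearMap K (fun _ : Fin (n i) => A) A)
    {t : ℕ} (B : Fin t → Submodule K A)
    (hmax : ∀ i, Multialg.IsMaximalSubalgebra μ (B i))
    (hrep : ∀ C, Multialg.IsMaximalSubalgebra μ C →
      ∃! i, ∃ g ∈ Multialg.autZero μ, C = (B i).map (g : A →ₗ[K] A))
    (r : ℕ) :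
    -- (i) the irreducible components
    Multialg.components (Multialg.zariski K (Fin r → A)) (Multialg.nonGenerating μ r) =
      {X | Maximal (fun Y => Y ∈ Set.range fun i => Multialg.sweep μ r (B i)) X} ∧
    -- (ii) the dimension, where `dZ`, `dG`, `dS i` are the dimensions of the set of
    -- non-generating tuples, of the group and of the stabilizers
    ∃ (dZ : WithBot ℕ) (dG : ℕ) (dS : Fin t → ℕ),
      Multialg.HasDim (Multialg.zariski K (Fin r → A)) (Multialg.nonGenerating μ r) dZ ∧
      Multialg.HasDim (Multialg.zariskiGL K A) (Multialg.autZero μ) dG ∧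
      (∀ i, Multialg.HasDim (Multialg.zariskiGL K A) (Multialg.stab μ (B i)) (dS i)) ∧
      dZ.map (Nat.cast : ℕ → ℤ) ≤ ((dG : ℤ) : WithBot ℤ) +
        Finset.univ.sup (fun i =>
          (((r : ℤ) * Module.finrank K (B i) - dS i : ℤ) : WithBot ℤ)) ∧
      ∀ i, (∀ j, (r : ℤ) * Module.finrank K (B j) - dS j ≤
            (r : ℤ) * Module.finrank K (B i) - dS i) →
        (∃ a : Fin r → A, Multialg.generated μ (Set.range a) = B i) →
        dZ.map (Nat.cast : ℕ → ℤ) = ((dG : ℤ) : WithBot ℤ) +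
          Finset.univ.sup (fun i =>
            (((r : ℤ) * Module.finrank K (B i) - dS i : ℤ) : WithBot ℤ)) := by
  have hZ := Multialg.nonGenerating_eq_iUnion_sweep μ hmax (fun C hC => (hrep C hC).exists) r
  have hcl := fun i => Multialg.isClosed_sweep μ r (B i)
  refine ⟨?_, ?_⟩
  · rw [hZ]
    exact FunAlg.components_iUnion _ hcl fun i => Multialg.isIrreducible_sweep μ r (B i)
  obtain ⟨dG, hdG, hG⟩ := Multialg.exists_hasDim_autZero μ
  choose dY dS hY hS hle heq using fun i => Multialg.exists_hasDim_sweep μ r (B i) hdG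
  have hmono : Monotone (WithBot.map (Nat.cast : ℕ → ℕ∞)) :=
    (Nat.mono_cast (α := ℕ∞)).withBot_map
  have hmono' : Monotone (WithBot.map (Nat.cast : ℕ → ℤ)) :=
    (Nat.mono_cast (α := ℤ)).withBot_map
  -- For `t = 0` this supremum is `⊥`, the dimension of the empty set.
  refine ⟨Finset.univ.sup fun i => (dY i : WithBot ℕ), dG, dS, ?_, hG, hS, ?_, ?_⟩
  · rw [hZ]
    let := Multialg.zariski K (Fin r → A)
    refine le_antisymm (FunAlg.topologicalKrullDim_iUnion_le hcl fun i => ?_) ?_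
    · exact (hY i).le.trans (hmono (Finset.le_sup (f := fun i => (dY i : WithBot ℕ))
        (Finset.mem_univ i)))
    · rw [Finset.apply_sup_eq_sup_comp_of_linearOrder _ hmono rfl]
      refine Finset.sup_le fun i _ => (hY i).ge.trans ?_
      exact (Topology.IsEmbedding.inclusion (Set.subset_iUnion
        (fun i => Multialg.sweep μ r (B i)) i)).isInducing.topologicalKrullDim_le
  · rw [Finset.apply_sup_eq_sup_comp_of_linearOrder _ hmono' rfl]
    refine Finset.sup_le fun i _ => ?_
    refine le_trans ?_ (add_le_add_right (Finset.le_sup (Finset.mem_univ i)) _)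
    have := hle i
    change ((dY i : ℤ) : WithBot ℤ) ≤ ((dG : ℤ) : WithBot ℤ) + _
    rw [← WithBot.coe_add, WithBot.coe_le_coe]
    zify at this
    linarith
  · intro i hi hgen
    have hsup : (Finset.univ.sup fun i =>
        (((r : ℤ) * Module.finrank K (B i) - dS i : ℤ) : WithBot ℤ)) =
          (((r : ℤ) * Module.finrank K (B i) - dS i : ℤ) : WithBot ℤ) :=
      le_antisymm (Finset.sup_le fun j _ => WithBot.coe_le_coe.2 (hi j))
        (Finset.le_sup (f := fun i => (((r : ℤ) * Module.finrank K (B i) - dS i : ℤ) : WithBot ℤ))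
          (Finset.mem_univ i))
    have hi' := heq i hgen
    -- The sweep of `B i` attains its bound, which dominates the bounds for all the others.
    have hsup' : (Finset.univ.sup fun i => (dY i : WithBot ℕ)) = dY i := by
      refine le_antisymm (Finset.sup_le fun j _ => WithBot.coe_le_coe.2 ?_)
        (Finset.le_sup (f := fun i => (dY i : WithBot ℕ)) (Finset.mem_univ i))
      have h1 := hle j
      have h2 := hi j
      zify at h1 hi' ⊢
      linarith
    rw [hsup, hsup']
    change ((dY i : ℤ) : WithBot ℤ) = _
    rw [← WithBot.coe_add, WithBot.coe_inj]
    zify at hi'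
    linarith
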